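/- **Setting.** Let $\mathcal X\subseteq\mathbb R^d$ ($d\ge1$) be compact and convex, with $r\mathbb B\subseteq\mathcal X$ for some $r>0$ and diameter at most $D_x$. Let $\Xi$ be a metric space with its Borel $\sigma$-algebra and let $J:\mathcal X\times\Xi\to\mathbb R$ satisfy $|J|\le U$, with $J(\cdot,\xi)$ convex and $L_0$-Lipschitz for every $\xi$, and $J(x,\cdot)$ $L_0$-Lipschitz for every $x$. For $\alpha\in(0,1]$ and a law $\mu$ on $\mathbb R$ with distribution function $F$ put $$\mathrm{CVaR}_\alpha[F]=\inf_{v\in\mathbb R}\Big\{v+\tfrac1\alpha\,\mathbb E_{Y\sim\mu}[(Y-v)_+]\Big\},$$ the mean of the $\alpha$-fraction of the largest outcomes. The noise at time $t$ has law $\mathcal D_t$ on $\Xi$, $C_t(x)=\mathrm{CVaR}_\alpha[J(x,\xi_t)]$ with $\xi_t\sim\mathcal D_t$, and $\sum_{t=2}^TW_1(\mathcal D_{t-1},\mathcal D_t)\le V_D$ with $V_D>0$, where $W_1(\mu,\nu)=\sup_f\{\int f\,d\mu-\int f\,d\nu\}$ over the integrable $1$-Lipschitz functions $f$. **Algorithm.**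 Given an integer batch length $1\le\Delta_T\le T$, a smoothing radius $0<\delta<r$, step sizes $\eta_t$, and sampling numbers $\phi(\tau)\ge1$ ($1\le\tau\le\Delta_T$), let $\mathcal X^\delta=\{x\in\mathcal X:\ x/(1-\delta/r)\in\mathcal X\}$ and start from a point $x_1\in\mathcal X^\delta$. For $t=1,\dots,T$ let $j=\lceil t/\Delta_T\rceil$, $\tau=t-(j-1)\Delta_T$ and $n_t=\phi(\tau)$; draw $u_t$ uniformly from the unit sphere, play $\hat x_t=x_t+\delta u_t$, observe $J(\hat x_t,\xi_t^i)$ for $i=1,\dots,n_t$ with $\xi_t^i\sim\mathcal D_t$ (all $u_t$ and $\xi_t^i$ independent), let $\hat F_t$ be the empirical distribution function of these $n_t$ values, and set $$\hat g_t=\tfrac d\delta\,\mathrm{CVaR}_\alpha[\hat F_t]\,u_t,\qquad x_{t+1}=\mathcal P_{\mathcal X^\delta}(x_t-\eta_t\hat g_t),$$ where $\mathcal P$ is Euclidean projection. The dynamic regret is $\mathrm{DR}(T)=\sum_{t=1}^TC_t(\hat x_t)-\sum_{t=1}^T\min_{x\in\mathcal X}C_t(x)$. **Theorem.** Suppose that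 $\sum_{\tau=1}^{\Delta_T}\frac1{\sqrt{\phi(\tau)}}\le c\,\Delta_T^{1-a/2}$ with constants $a,c>0$. There is a constant $K>0$ that depends only on $d,r,U,L_0,D_x,\alpha,a,c$ (not on $T$, $V_D$, $\phi$, $\Xi$, the laws $\mathcal D_t$, the set $\mathcal X$ or the cost $J$) such that for all $T\ge1$, all $V_D>0$ and all $\gamma\in(0,1)$ the following holds whenever the choices below satisfy $\delta<r$ and $1\le\Delta_T\le T$. 1. If $a\in(0,1]$, $\delta=(V_D/T)^{\frac a{4+a}}$, $\eta_t=(V_D/T)^{\frac{3a}{4+a}}$ and $\Delta_T$ is $(T/V_D)^{\frac4{4+a}}$ rounded (up or down) to an integer, then with probability at least $1-\gamma$ $$\mathrm{DR}(T)\le K\sqrt{\ln(2T/\gamma)}\;T^{\frac4{4+a}}V_D^{\frac a{4+a}}.$$ 2. If $a>1$, $\delta=(V_D/T)^{\frac15}$, $\eta_t=(V_D/T)^{\frac35}$ and $\Delta_T$ is $(T/V_D)^{\frac45}$ rounded (up or down) to an integer, then with probability at least $1-\gamma$ $$\mathrm{DR}(T)\le K\sqrt{\ln(2T/\gamma)}\;T^{\frac45}V_D^{\frac15}.$$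 In particular $\mathrm{DR}(T)=\tilde{\mathcal O}(T^{4/(4+a)}V_D^{a/(4+a)})$, respectively $\tilde{\mathcal O}(T^{4/5}V_D^{1/5})$, with high probability. -/

import Mathlib

open MeasureTheory ProbabilityTheory
open scoped ENNReal

namespace RiskAverse

/-- The decision space `ℝ^d` with the `l₂` norm. -/
abbrev Vec (d : ℕ) : Type := EuclideanSpace ℝ (Fin d)

/-- The unit sphere of `ℝ^d`. -/
abbrev UnitSphere (d : ℕ) : Type := Metric.sphere (0 : Vec d) 1

/-- The uniform probability measure on the unit sphere of `ℝ^d` (`1 ≤ d`). -/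
noncomputable def sphereUniform (d : ℕ) : Measure (UnitSphere d) :=
  ((volume : Measure (Vec d)).toSphere Set.univ)⁻¹ • (volume : Measure (Vec d)).toSphere

/-- Conditional value-at-risk of a law `μ` of costs on the real line at level `α ∈ (0,1]`, that is,
the mean of the `α`-fraction of the worst (largest) outcomes, in the Rockafellar–Uryasev form, which
is the one that also makes sense for laws with atoms, such as empirical distributions. -/
noncomputable def cvar (α : ℝ) (μ : Measure ℝ) : ℝ :=
  ⨅ v : ℝ, (v + α⁻¹ * ∫ y, max (y - v) 0 ∂μ)

/-- If the outcomes `≥ q` have probability exactly `α`, then the conditional value-at-risk is the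
conditional expectation of the outcome given that it is `≥ q`. -/
theorem cvar_eq_tail_mean {α : ℝ} (hα : 0 < α) (μ : Measure ℝ) [IsProbabilityMeasure μ]
    (hint : Integrable (fun y => y) μ) {q : ℝ} (hq : μ.real (Set.Ici q) = α) :
    cvar α μ = ∫ y, y ∂(μ[|Set.Ici q]) := by
  have hcond : ∫ y, y ∂(μ[|Set.Ici q]) = α⁻¹ * ∫ y in Set.Ici q, y ∂μ := by
    rw [ProbabilityTheory.cond, integral_smul_measure, ENNReal.toReal_inv, ← measureReal_def, hq,
      smul_eq_mul]
  have hpos : ∀ v : ℝ, Integrable (fun y => max (y - v) 0) μ := fun v =>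
    (hint.sub (integrable_const v)).pos_part
  have htail : ∀ v : ℝ, ∫ y in Set.Ici q, (y - v) ∂μ = (∫ y in Set.Ici q, y ∂μ) - α * v := by
    intro v
    rw [integral_sub hint.integrableOn (integrable_const v), setIntegral_const, hq, smul_eq_mul]
  have hlow : ∀ v : ℝ, α⁻¹ * ∫ y in Set.Ici q, y ∂μ ≤ v + α⁻¹ * ∫ y, max (y - v) 0 ∂μ := by
    intro v
    have h1 : ∫ y in Set.Ici q, (y - v) ∂μ ≤ ∫ y, max (y - v) 0 ∂μ :=
      calc ∫ y in Set.Ici q, (y - v) ∂μ ≤ ∫ y in Set.Ici q, max (y - v) 0 ∂μ :=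
            integral_mono (hint.sub (integrable_const v)).integrableOn (hpos v).integrableOn
              (fun y => le_max_left _ _)
        _ ≤ ∫ y, max (y - v) 0 ∂μ :=
            setIntegral_le_integral (hpos v) (Filter.Eventually.of_forall fun y => le_max_right _ _)
    rw [htail v] at h1
    have h2 := mul_le_mul_of_nonneg_left h1 (inv_nonneg.2 hα.le)
    have h3 : α⁻¹ * ((∫ y in Set.Ici q, y ∂μ) - α * v)
        = α⁻¹ * (∫ y in Set.Ici q, y ∂μ) - v := by field_simp
    linarith
  have heq : q + α⁻¹ * ∫ y, max (y - q) 0 ∂μ = α⁻¹ * ∫ y in Set.Ici q, y ∂μ := by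
    have h1 : ∫ y, max (y - q) 0 ∂μ = ∫ y in Set.Ici q, (y - q) ∂μ := by
      rw [← integral_indicator measurableSet_Ici]
      refine integral_congr_ae (Filter.Eventually.of_forall fun y => ?_)
      by_cases hy : q ≤ y
      · simp [Set.indicator, hy]
      · simp [Set.indicator, hy, (not_le.1 hy).le]
    rw [h1, htail q]
    field_simp
    ring
  rw [hcond]
  apply le_antisymm
  · rw [← heq]
    exact ciInf_le ⟨_, by rintro _ ⟨v, rfl⟩; exact hlow v⟩ q
  · exact le_ciInf hlow

/-- The risk-averse cost `C(x) = CVaR_α[J(x, ξ)]`, `ξ ∼ D`. -/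
noncomputable def riskCost {d : ℕ} {Ξ : Type*} [MeasurableSpace Ξ] (J : Vec d → Ξ → ℝ) (α : ℝ)
    (D : Measure Ξ) (x : Vec d) : ℝ :=
  cvar α (D.map (J x))

/-- The Wasserstein-1 distance in its Kantorovich–Rubinstein form: the supremum of
`∫ f dμ - ∫ f dν` over the 1-Lipschitz functions `f` that are integrable for both measures. -/
noncomputable def wasserstein {Ξ : Type*} [PseudoEMetricSpace Ξ] [MeasurableSpace Ξ]
    (μ ν : Measure Ξ) : ℝ≥0∞ :=
  ⨆ (f : Ξ → ℝ) (_ : LipschitzWith 1 f) (_ : Integrable f μ) (_ : Integrable f ν),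
    ENNReal.ofReal (∫ z, f z ∂μ - ∫ z, f z ∂ν)

/-- The law that puts mass `1/n` on each of the samples `y 1, …, y n`; its distribution function is
the empirical distribution function `t ↦ (1/n) #{i : y i ≤ t}`. -/
noncomputable def empiricalLaw (n : ℕ) (y : ℕ → ℝ) : Measure ℝ :=
  (n : ℝ≥0∞)⁻¹ • ∑ i ∈ Finset.Icc 1 n, Measure.dirac (y i)

/-- The shrunk feasible set `{x ∈ X | x / (1 - δ/r) ∈ X}`. -/
def shrunkSet {d : ℕ} (X : Set (Vec d)) (r δ : ℝ) : Set (Vec d) :=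
  {x | x ∈ X ∧ (1 / (1 - δ / r)) • x ∈ X}

/-- Euclidean projection: a point of `S` nearest to `x` (there is exactly one if `S` is nonempty,
closed and convex). -/
noncomputable def proj {d : ℕ} (S : Set (Vec d)) (x : Vec d) : Vec d :=
  Classical.epsilon fun y => y ∈ S ∧ ∀ w ∈ S, ‖x - y‖ ^ 2 ≤ ‖x - w‖ ^ 2

/-- The batch `j = ⌈t/Δ⌉` of iteration `t ≥ 1` when batches have length `Δ`. -/
def batch (Δ t : ℕ) : ℕ := ⌈(t : ℚ) / (Δ : ℚ)⌉₊

/-- The epoch `τ = t - (j - 1) Δ ∈ {1, …, Δ}` of iteration `t ≥ 1` inside its batch `j`. -/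
def epoch (Δ t : ℕ) : ℕ := t - (batch Δ t - 1) * Δ

/-- The inputs of the algorithm: feasible set `X` (containing the ball of radius `r`), cost `J`,
risk level `α`, batch length `Δ`, smoothing parameter `δ`, sampling numbers `φ` and learning rates
`σ` (as functions of the epoch), and initial action. -/
structure AlgInput (d : ℕ) (Ξ : Type*) where
  X : Set (Vec d)
  r : ℝ
  J : Vec d → Ξ → ℝ
  α : ℝ
  Δ : ℕ
  δ : ℝ
  φ : ℕ → ℕ
  σ : ℕ → ℝ
  init : Vec d

namespace AlgInput

variable {d : ℕ} {Ξ : Type*} (A : AlgInput d Ξ)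

/-- The gradient estimate `ĝ = (d/δ) CVaR_α[F̂] u` at the point `x` in iteration `t`, where `F̂` is
the empirical distribution of `J(x + δ u, z i)`, `i = 1, …, φ(τ)`, with `τ` the epoch of `t`. -/
noncomputable def gradEst (t : ℕ) (x : Vec d) (u : UnitSphere d) (z : ℕ → Ξ) : Vec d :=
  ((d : ℝ) / A.δ *
    cvar A.α (empiricalLaw (A.φ (epoch A.Δ t)) fun i => A.J (x + A.δ • (u : Vec d)) (z i))) •
    (u : Vec d)

/-- The iterates `x_t`, `t ≥ 1` (the value at `t = 0` is not used), of the restarted algorithm, for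
directions `u t` and noise samples `z t i`. -/
noncomputable def iterate (u : ℕ → UnitSphere d) (z : ℕ → ℕ → Ξ) : ℕ → Vec d
  | 0 => A.init
  | 1 => A.init
  | t + 2 => proj (shrunkSet A.X A.r A.δ)
      (iterate u z (t + 1) - A.σ (epoch A.Δ (t + 1)) •
        A.gradEst (t + 1) (iterate u z (t + 1)) (u (t + 1)) (z (t + 1)))

/-- The action `x̂_t = x_t + δ u_t` played in iteration `t`. -/
noncomputable def action (u : ℕ → UnitSphere d) (z : ℕ → ℕ → Ξ) (t : ℕ) : Vec d :=
  A.iterate u z t + A.δ • (u t : Vec d)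

end AlgInput

/-- The dynamic regret of the actions `xhat 1, …, xhat T` against the comparators
`xstar 1, …, xstar T` for the costs `C 1, …, C T`. -/
noncomputable def dynamicRegret {d : ℕ} (C : ℕ → Vec d → ℝ) (xhat xstar : ℕ → Vec d) (T : ℕ) : ℝ :=
  ∑ t ∈ Finset.Icc 1 T, C t (xhat t) - ∑ t ∈ Finset.Icc 1 T, C t (xstar t)

/-- The random inputs of the algorithm: directions `u t` uniform on the unit sphere and noise samples
`ξ t i` of law `D t`, all of them mutually independent. -/
structure SampleModel {d : ℕ} {Ξ Ω : Type*} [MeasurableSpace Ξ] [MeasurableSpace Ω]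
    (P : Measure Ω) (D : ℕ → Measure Ξ) (u : ℕ → Ω → UnitSphere d) (ξ : ℕ → ℕ → Ω → Ξ) :
    Prop where
  measurable_u : ∀ t, Measurable (u t)
  measurable_noise : ∀ t i, Measurable (ξ t i)
  law_u : ∀ t, P.map (u t) = sphereUniform d
  law_noise : ∀ t i, P.map (ξ t i) = D t
  indep_u : iIndepFun u P
  indep_noise : iIndepFun (fun p : ℕ × ℕ => ξ p.1 p.2) P
  indep_u_noise : IndepFun (fun ω t => u t ω) (fun ω (p : ℕ × ℕ) => ξ p.1 p.2 ω) P

end RiskAverse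

open RiskAverse

/-!
# Dynamic regret of zeroth-order risk-averse learning

The regret of the played actions is split into the cost of playing `x_t + δ u_t` instead of `x_t`,
the regret of `x_t` against the shrunk minimizer `y_t` of the first cost of the current batch, the
cost of shrinking, and the cost of keeping that minimizer during the batch. The last part is at most
`2 Δ (L₀/α)` times the total Wasserstein variation, because the risk-averse costs are Lipschitz in
the noise distribution (`sum_batchStart_sub_le`, `abs_riskCost_sub_le_wasserstein`).

The regret of `x_t` against `y_t` rests on three facts.

* In mean, the estimate `(d/δ) C(x + δ u) u` behaves like a subgradient of the convex function `C`
  at `x`, up to an error of order `δ` (`sub_le_integral_gradEst`). No divergence theorem is needed: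
  to bound the mean of `C(x + δ u) ⟨u, x - y⟩`, pair `u` with its mirror image in the hyperplane
  orthogonal to `x - y`. The difference of the two values of `C` is the increment along a chord
  parallel to `x - y`, and the slopes of `C` along that line dominate `C(x) - C(y) - O(δ)`. What
  remains is the second moment `‖w‖² / d` of `⟨u, w⟩`.
* Replacing `C` by the empirical conditional value-at-risk of `n` samples costs `O(1/√n)` in mean
  (`integral_abs_cvar_empiricalLaw_sub_le`): the conditional value-at-risk is Lipschitz for the `L¹`
  distance of the tail functions, and each tail frequency has variance at most `1/n`.
* The sums of `⟨ĝ_t, x_t - y_t⟩` and of their means given the past differ by `O(√(T log (1/γ)) / δ)`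
  with probability `1 - γ` (`measureReal_sum_ge_le`), since every round is independent of its past.
  The underlying space need not be standard Borel, so conditional expectations are replaced by
  integrals with respect to a fresh copy of the round, which is Fubini's theorem for the joint law.

Projected gradient descent with constant step size bounds the sum of the `⟨ĝ_t, x_t - y_t⟩`
pathwise; the comparator changes at most `T / Δ` times (`sum_sq_dist_le`). For `a ≤ 1` the
prescribed parameters make every term `O(T δ)` (`regret_rate`). For `a > 1` the hypothesis
on the sampling numbers holds with `1` in place of `a` as well, because `Δ ≥ 1`, and the second
claim is the first one at `a = 1`.
-/

namespace RiskAverse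

/-! ### Conditional value-at-risk of bounded outcomes -/

section CVaR

variable {α U : ℝ} {μ ν : Measure ℝ} [IsProbabilityMeasure μ]

lemma integrable_excess (hμ : ∀ᵐ y ∂μ, |y| ≤ U) (v : ℝ) :
    Integrable (fun y => max (y - v) 0) μ := by
  have : Integrable (fun y : ℝ => y) μ :=
    Integrable.of_bound (by fun_prop) U (by simpa using hμ)
  exact (this.sub (integrable_const v)).pos_part

lemma neg_le_cvar_objective (hα : 0 < α) (hα1 : α ≤ 1) (hμ : ∀ᵐ y ∂μ, |y| ≤ U) (v : ℝ) :
    -U ≤ v + α⁻¹ * ∫ y, max (y - v) 0 ∂μ := by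
  have h0 : 0 ≤ ∫ y, max (y - v) 0 ∂μ := integral_nonneg fun y => le_max_right _ _
  have h1 : -U - v ≤ ∫ y, max (y - v) 0 ∂μ := by
    have : ∫ _ : ℝ, (-U - v) ∂μ ≤ ∫ y, max (y - v) 0 ∂μ := by
      refine integral_mono_ae (integrable_const _) (integrable_excess hμ v) ?_
      filter_upwards [hμ] with y hy
      exact le_max_of_le_left (by linarith [(abs_le.1 hy).1])
    simpa using this
  have h2 : 1 ≤ α⁻¹ := (one_le_inv₀ hα).2 hα1
  nlinarith

lemma bddBelow_cvar_objective (hα : 0 < α) (hα1 : α ≤ 1) (hμ : ∀ᵐ y ∂μ, |y| ≤ U) :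
    BddBelow (Set.range fun v : ℝ => v + α⁻¹ * ∫ y, max (y - v) 0 ∂μ) :=
  ⟨-U, by rintro _ ⟨v, rfl⟩; exact neg_le_cvar_objective hα hα1 hμ v⟩

lemma abs_cvar_le (hα : 0 < α) (hα1 : α ≤ 1) (hμ : ∀ᵐ y ∂μ, |y| ≤ U) : |cvar α μ| ≤ U := by
  refine abs_le.2 ⟨le_ciInf (neg_le_cvar_objective hα hα1 hμ), ?_⟩
  refine (ciInf_le (bddBelow_cvar_objective hα hα1 hμ) U).trans (le_of_eq ?_)
  have : ∫ y, max (y - U) 0 ∂μ = 0 := by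
    refine integral_eq_zero_of_ae ?_
    filter_upwards [hμ] with y hy
    exact max_eq_right (by linarith [(abs_le.1 hy).2])
  simp [this]

lemma cvar_le_add (hα : 0 < α) (hα1 : α ≤ 1) (hμ : ∀ᵐ y ∂μ, |y| ≤ U) {ε : ℝ}
    (h : ∀ v, ∫ y, max (y - v) 0 ∂μ ≤ ∫ y, max (y - v) 0 ∂ν + ε) :
    cvar α μ ≤ cvar α ν + α⁻¹ * ε := by
  have : cvar α μ - α⁻¹ * ε ≤ cvar α ν := by
    refine le_ciInf fun v => ?_
    have h1 : cvar α μ ≤ v + α⁻¹ * ∫ y, max (y - v) 0 ∂μ :=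
      ciInf_le (bddBelow_cvar_objective hα hα1 hμ) v
    have h2 := mul_le_mul_of_nonneg_left (h v) (inv_nonneg.2 hα.le)
    linarith
  linarith

/-- The excess over `v` is a layer-cake integral of tail probabilities over the range `[-U, U]` of
the outcomes, up to a constant that does not depend on the law. -/
lemma integral_excess_eq (hμ : ∀ᵐ y ∂μ, |y| ≤ U) (v : ℝ) :
    ∫ y, max (y - v) 0 ∂μ =
      max (-U - v) 0 + ∫ s in Set.Ioc (-U) U, (Set.Ici v).indicator 1 s * μ.real (Set.Ioi s) := by
  have hmeas : MeasurableSet {p : ℝ × ℝ | p.2 < p.1} :=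
    measurableSet_lt measurable_snd measurable_fst
  have hpt : ∀ᵐ y ∂μ, max (y - v) 0 = max (-U - v) 0 +
      ∫ s in Set.Ioc (-U) U, (Set.Ici v).indicator 1 s * (Set.Iio y).indicator (1 : ℝ → ℝ) s := by
    filter_upwards [hμ] with y hy
    obtain ⟨h1, h2⟩ := abs_le.1 hy
    have h3 : ∫ s in Set.Ioc (-U) U, (Set.Ici v).indicator 1 s * (Set.Iio y).indicator (1 : ℝ → ℝ) s
        = volume.real (Set.Ico v y ∩ Set.Ioc (-U) U) := by
      have : (fun s => (Set.Ici v).indicator 1 s * (Set.Iio y).indicator (1 : ℝ → ℝ) s)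
          = (Set.Ico v y).indicator 1 := by
        ext s
        by_cases h1 : v ≤ s <;> by_cases h2 : s < y <;> simp [h1, h2]
      rw [this, integral_indicator_one measurableSet_Ico,
        measureReal_restrict_apply measurableSet_Ico]
    have h4 : volume.real (Set.Ico v y ∩ Set.Ioc (-U) U) = max (y - max v (-U)) 0 := by
      have : (Set.Ico v y ∩ Set.Ioc (-U) U : Set ℝ) =ᵐ[volume] Set.Ioo (max v (-U)) y := by
        have e : Set.Ioo (max v (-U)) y = Set.Ioo v y ∩ Set.Ioc (-U) U := by
          ext s; simp only [Set.mem_Ioo, Set.mem_inter_iff, Set.mem_Ioc, max_lt_iff]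
          constructor
          · rintro ⟨⟨a, b⟩, c⟩; exact ⟨⟨a, c⟩, b, by linarith⟩
          · rintro ⟨⟨a, c⟩, b, _⟩; exact ⟨⟨a, b⟩, c⟩
        rw [e]
        exact Ioo_ae_eq_Ico.symm.inter (ae_eq_refl _)
      rw [measureReal_congr this, Real.volume_real_Ioo]
    rw [h3, h4]
    rcases le_total v (-U) with h | h
    · rw [max_eq_right h, max_eq_left (by linarith : 0 ≤ y - v),
        max_eq_left (by linarith : 0 ≤ -U - v), max_eq_left (by linarith)]; ring
    · rw [max_eq_left h, max_eq_right (by linarith : -U - v ≤ 0), zero_add]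
  have hint : Integrable (Function.uncurry fun (y s : ℝ) =>
      (Set.Ici v).indicator 1 s * (Set.Iio y).indicator (1 : ℝ → ℝ) s)
      (μ.prod (volume.restrict (Set.Ioc (-U) U))) := by
    refine Integrable.of_bound (C := 1) ?_ (.of_forall fun p => ?_)
    · refine Measurable.aestronglyMeasurable ?_
      refine Measurable.mul ((measurable_one.indicator measurableSet_Ici).comp measurable_snd) ?_
      have : (fun p : ℝ × ℝ => (Set.Iio p.1).indicator (1 : ℝ → ℝ) p.2)
          = {p : ℝ × ℝ | p.2 < p.1}.indicator 1 := by ext p; simp [Set.indicator]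
      rw [this]
      exact measurable_one.indicator hmeas
    · simp only [Function.uncurry, Set.indicator, Set.mem_Ici, Set.mem_Iio, Pi.one_apply]
      split_ifs <;> simp
  rw [integral_congr_ae hpt, integral_add (integrable_const _)
    (by simpa using hint.integral_prod_left), integral_integral_swap hint]
  simp only [integral_const, probReal_univ, one_smul, integral_const_mul]
  congr 1
  refine integral_congr_ae (.of_forall fun s => ?_)
  have : (fun y => (Set.Iio y).indicator (1 : ℝ → ℝ) s) = (Set.Ioi s).indicator 1 := by
    ext y; simp [Set.indicator]
  simp only [this, integral_indicator_one measurableSet_Ioi]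

lemma integrable_tail (μ : Measure ℝ) [IsFiniteMeasure μ] (U : ℝ) :
    Integrable (fun s => μ.real (Set.Ioi s)) (volume.restrict (Set.Ioc (-U) U)) := by
  refine Integrable.of_bound (C := μ.real Set.univ) ?_ (.of_forall fun s => ?_)
  · refine (Antitone.measurable fun s t h => ?_).aestronglyMeasurable
    exact measureReal_mono (Set.Ioi_subset_Ioi h)
  · rw [Real.norm_of_nonneg measureReal_nonneg]
    exact measureReal_mono (Set.subset_univ _)

/-- The conditional value-at-risk is Lipschitz for the `L¹` distance of the tail functions. -/
lemma abs_cvar_sub_le_integral_tail [IsProbabilityMeasure ν] (hα : 0 < α) (hα1 : α ≤ 1)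
    (hμ : ∀ᵐ y ∂μ, |y| ≤ U) (hν : ∀ᵐ y ∂ν, |y| ≤ U) :
    |cvar α μ - cvar α ν| ≤
      α⁻¹ * ∫ s in Set.Ioc (-U) U, |μ.real (Set.Ioi s) - ν.real (Set.Ioi s)| := by
  have key : ∀ v, |∫ y, max (y - v) 0 ∂μ - ∫ y, max (y - v) 0 ∂ν| ≤
      ∫ s in Set.Ioc (-U) U, |μ.real (Set.Ioi s) - ν.real (Set.Ioi s)| := by
    intro v
    have hi : ∀ (ρ : Measure ℝ) [IsProbabilityMeasure ρ], Integrable (fun s =>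
        (Set.Ici v).indicator 1 s * ρ.real (Set.Ioi s)) (volume.restrict (Set.Ioc (-U) U)) := by
      intro ρ _
      refine (integrable_tail ρ U).bdd_mul (c := 1)
        (measurable_one.indicator measurableSet_Ici).aestronglyMeasurable (.of_forall fun s => ?_)
      simp only [Set.indicator, Pi.one_apply]; split_ifs <;> simp
    rw [integral_excess_eq hμ, integral_excess_eq hν, add_sub_add_left_eq_sub,
      ← integral_sub (hi μ) (hi ν)]
    refine abs_integral_le_integral_abs.trans (integral_mono ((hi μ).sub (hi ν)).abs
      ((integrable_tail μ U).sub (integrable_tail ν U)).abs fun s => ?_)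
    simp only [← mul_sub, abs_mul]
    refine mul_le_of_le_one_left (abs_nonneg _) ?_
    simp only [Set.indicator, Pi.one_apply]; split_ifs <;> simp
  have h1 := cvar_le_add hα hα1 hμ fun v => sub_le_iff_le_add'.1 (abs_le.1 (key v)).2
  have h2 := cvar_le_add (ν := μ) hα hα1 hν fun v => neg_le_sub_iff_le_add.1 (abs_le.1 (key v)).1
  exact abs_le.2 ⟨by linarith, by linarith⟩

end CVaR

/-! ### Empirical laws -/

lemma isProbabilityMeasure_empiricalLaw {n : ℕ} (hn : 1 ≤ n) (y : ℕ → ℝ) :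
    IsProbabilityMeasure (empiricalLaw n y) := by
  constructor
  have : (n : ℝ≥0∞) ≠ 0 := by simp; omega
  simp [empiricalLaw, ENNReal.inv_mul_cancel this]

lemma integral_empiricalLaw (n : ℕ) (y : ℕ → ℝ) {f : ℝ → ℝ} :
    ∫ s, f s ∂(empiricalLaw n y) = (n : ℝ)⁻¹ * ∑ i ∈ Finset.Icc 1 n, f (y i) := by
  rw [empiricalLaw, integral_smul_measure, integral_finsetSum_measure]
  · simp
  · intro i _
    exact integrable_dirac (by simp)

lemma ae_empiricalLaw {n : ℕ} {y : ℕ → ℝ} {p : ℝ → Prop} (h : ∀ i ∈ Finset.Icc 1 n, p (y i)) :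
    ∀ᵐ s ∂(empiricalLaw n y), p s := by
  refine Measure.ae_smul_measure ?_ _
  rw [ae_iff, Measure.coe_finsetSum, Finset.sum_apply, Finset.sum_eq_zero]
  intro i hi
  rw [← ae_iff, ae_dirac_eq]
  exact h i hi

lemma abs_cvar_empiricalLaw_le {α U : ℝ} (hα : 0 < α) (hα1 : α ≤ 1) {n : ℕ} (hn : 1 ≤ n)
    {y : ℕ → ℝ} (hy : ∀ i, |y i| ≤ U) : |cvar α (empiricalLaw n y)| ≤ U :=
  have := isProbabilityMeasure_empiricalLaw hn y
  abs_cvar_le hα hα1 (ae_empiricalLaw fun i _ => hy i)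

lemma cvar_empiricalLaw_le_add {α : ℝ} (hα : 0 < α) (hα1 : α ≤ 1) {n : ℕ} (hn : 1 ≤ n)
    (y y' : ℕ → ℝ) : cvar α (empiricalLaw n y) ≤ cvar α (empiricalLaw n y') +
      α⁻¹ * ∑ i ∈ Finset.Icc 1 n, |y i - y' i| := by
  have := isProbabilityMeasure_empiricalLaw hn y
  have := isProbabilityMeasure_empiricalLaw hn y'
  refine cvar_le_add (U := ∑ i ∈ Finset.Icc 1 n, |y i|) hα hα1 (ae_empiricalLaw fun i hi =>
    Finset.single_le_sum (f := fun i => |y i|) (fun _ _ => abs_nonneg _) hi) fun v => ?_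
  rw [integral_empiricalLaw, integral_empiricalLaw]
  have h1 : (n : ℝ)⁻¹ ≤ 1 := inv_le_one_of_one_le₀ (by exact_mod_cast hn)
  have h2 : 0 ≤ (n : ℝ)⁻¹ := by positivity
  have h3 : 0 ≤ ∑ i ∈ Finset.Icc 1 n, |y i - y' i| := Finset.sum_nonneg fun _ _ => abs_nonneg _
  have h4 : ∑ i ∈ Finset.Icc 1 n, max (y i - v) 0 ≤
      ∑ i ∈ Finset.Icc 1 n, max (y' i - v) 0 + ∑ i ∈ Finset.Icc 1 n, |y i - y' i| := by
    rw [← Finset.sum_add_distrib]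
    refine Finset.sum_le_sum fun i _ => max_le ?_ ?_
    · linarith [le_abs_self (y i - y' i), le_max_left (y' i - v) 0]
    · linarith [abs_nonneg (y i - y' i), le_max_right (y' i - v) 0]
  nlinarith

lemma continuous_cvar_empiricalLaw {α : ℝ} (hα : 0 < α) (hα1 : α ≤ 1) {n : ℕ} (hn : 1 ≤ n) :
    Continuous fun y : ℕ → ℝ => cvar α (empiricalLaw n y) := by
  rw [continuous_iff_continuousAt]
  intro y₀
  have hb : ∀ y : ℕ → ℝ, |cvar α (empiricalLaw n y) - cvar α (empiricalLaw n y₀)| ≤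
      α⁻¹ * ∑ i ∈ Finset.Icc 1 n, |y i - y₀ i| := by
    intro y
    have h1 := cvar_empiricalLaw_le_add hα hα1 hn y y₀
    have h2 := cvar_empiricalLaw_le_add hα hα1 hn y₀ y
    simp only [abs_sub_comm (y₀ _)] at h2
    exact abs_le.2 ⟨by linarith, by linarith⟩
  refine tendsto_iff_dist_tendsto_zero.2 (squeeze_zero (fun _ => dist_nonneg) hb ?_)
  have : Continuous fun y : ℕ → ℝ => α⁻¹ * ∑ i ∈ Finset.Icc 1 n, |y i - y₀ i| := by fun_prop
  simpa using this.tendsto y₀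

/-- The empirical frequency of an event has mean absolute error at most `1/√n`, because its
variance is at most `1/n`. -/
lemma integral_abs_mean_sub_le {Ω : Type*} [MeasurableSpace Ω] {P : Measure Ω}
    [IsProbabilityMeasure P] {n : ℕ} (hn : 1 ≤ n) {B : ℕ → Ω → ℝ} (hB : ∀ i, Measurable (B i))
    (h01 : ∀ i ω, B i ω ∈ Set.Icc (0 : ℝ) 1)
    (hind : Pairwise fun i j => IndepFun (B i) (B j) P) {p : ℝ} (hp : ∀ i, ∫ ω, B i ω ∂P = p) :
    ∫ ω, |(n : ℝ)⁻¹ * ∑ i ∈ Finset.Icc 1 n, B i ω - p| ∂P ≤ 1 / √(n : ℝ) := by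
  have hn0 : (0 : ℝ) < n := by exact_mod_cast hn
  have hs : 0 < √(n : ℝ) := Real.sqrt_pos.2 hn0
  have hss : √(n : ℝ) * √(n : ℝ) = n := Real.mul_self_sqrt hn0.le
  have hL : ∀ i, MemLp (B i) 2 P := fun i =>
    MemLp.of_bound (hB i).aestronglyMeasurable 1 (.of_forall fun ω => by
      rw [Real.norm_of_nonneg (h01 i ω).1]; exact (h01 i ω).2)
  have hvar : Var[∑ i ∈ Finset.Icc 1 n, B i; P] ≤ n := by
    rw [IndepFun.variance_sum (fun i _ => hL i) (fun i _ j _ hij => hind hij)]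
    calc ∑ i ∈ Finset.Icc 1 n, Var[B i; P] ≤ ∑ i ∈ Finset.Icc 1 n, (1 : ℝ) := by
          refine Finset.sum_le_sum fun i _ => ?_
          refine (variance_le_sq_of_bounded (.of_forall (h01 i)) (hB i).aemeasurable).trans ?_
          norm_num
      _ = n := by simp
  have hS : MemLp (∑ i ∈ Finset.Icc 1 n, B i) 2 P := memLp_finsetSum' _ fun i _ => hL i
  have hmean : P[∑ i ∈ Finset.Icc 1 n, B i] = n * p := by
    simp only [Finset.sum_apply]
    rw [integral_finsetSum _ fun i _ => (hL i).integrable (by norm_num)]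
    simp [hp]
  rw [variance_eq_integral hS.aemeasurable, hmean] at hvar
  have hSi := hS.integrable (by norm_num)
  have hsq : Integrable (fun ω => ((∑ i ∈ Finset.Icc 1 n, B i) ω - n * p) ^ 2) P :=
    (hS.sub (memLp_const _)).integrable_sq
  calc ∫ ω, |(n : ℝ)⁻¹ * ∑ i ∈ Finset.Icc 1 n, B i ω - p| ∂P
      ≤ ∫ ω, (((∑ i ∈ Finset.Icc 1 n, B i) ω - n * p) ^ 2 / (2 * n * √n) + 1 / (2 * √n)) ∂P := by
        refine integral_mono_of_nonneg (.of_forall fun _ => abs_nonneg _)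
          ((hsq.div_const _).add (integrable_const _)) (.of_forall fun ω => ?_)
        simp only [Finset.sum_apply]
        set S := ∑ i ∈ Finset.Icc 1 n, B i ω
        -- `|z| ≤ (√n z² + 1/√n) / 2` for the centred mean `z`
        have e : (n : ℝ)⁻¹ * S - p = (S - n * p) / n := by field_simp
        rw [e, abs_div, abs_of_pos hn0, div_add_div _ _ (by positivity) (by positivity),
          div_le_div_iff₀ hn0 (by positivity)]
        set w := S - n * p
        have h2 : |w| ^ 2 = w ^ 2 := sq_abs w
        have h3 : 0 ≤ (2 * √(n : ℝ) * n) * (|w| - √n) ^ 2 := by positivity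
        linear_combination h3 + 2 * √(n : ℝ) * n * h2 + 2 * n * √(n : ℝ) * hss
    _ ≤ 1 / √(n : ℝ) := by
        rw [integral_add (hsq.div_const _) (integrable_const _), integral_div]
        simp only [integral_const, probReal_univ, one_smul]
        have : (∫ ω, ((∑ i ∈ Finset.Icc 1 n, B i) ω - n * p) ^ 2 ∂P) / (2 * n * √n)
            ≤ n / (2 * n * √n) := by gcongr
        refine (add_le_add_left this _).trans (le_of_eq ?_)
        field_simp; norm_num

/-- The conditional value-at-risk of the empirical law of `n` independent samples approximates that
of the sampled law to order `1/√n` in mean. The error is integrated over the levels `s` before the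
expectation is taken, so no uniform bound on the empirical distribution function is needed. -/
lemma integral_abs_cvar_empiricalLaw_sub_le {Ω : Type*} [MeasurableSpace Ω] {P : Measure Ω}
    [IsProbabilityMeasure P] {α U : ℝ} (hU : 0 ≤ U) (hα : 0 < α) (hα1 : α ≤ 1) {n : ℕ}
    (hn : 1 ≤ n) {Y : ℕ → Ω → ℝ} (hY : ∀ i, Measurable (Y i)) (hYU : ∀ i ω, |Y i ω| ≤ U)
    (hind : Pairwise fun i j => IndepFun (Y i) (Y j) P)
    {ν : Measure ℝ} (hν : ∀ i, P.map (Y i) = ν) :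
    ∫ ω, |cvar α (empiricalLaw n fun i => Y i ω) - cvar α ν| ∂P ≤ 2 * U / α / √(n : ℝ) := by
  have : IsProbabilityMeasure ν := by
    rw [← hν 0]; exact Measure.isProbabilityMeasure_map (hY 0).aemeasurable
  have hνU : ∀ᵐ y ∂ν, |y| ≤ U := by
    rw [← hν 0, ae_map_iff (hY 0).aemeasurable (measurableSet_le (by fun_prop) (by fun_prop))]
    exact .of_forall (hYU 0)
  let B : ℝ → ℕ → Ω → ℝ := fun s i ω => (Set.Ioi s).indicator 1 (Y i ω)
  have hBm : Measurable fun p : Ω × ℝ => fun i => B p.2 i p.1 := by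
    refine measurable_pi_lambda _ fun i => ?_
    have : (fun p : Ω × ℝ => B p.2 i p.1) = {p : Ω × ℝ | p.2 < Y i p.1}.indicator 1 := by
      ext p; simp [B, Set.indicator]
    rw [this]
    exact measurable_one.indicator (measurableSet_lt measurable_snd ((hY i).comp measurable_fst))
  have htail : ∀ ω s, (empiricalLaw n fun i => Y i ω).real (Set.Ioi s)
      = (n : ℝ)⁻¹ * ∑ i ∈ Finset.Icc 1 n, B s i ω := by
    intro ω s
    rw [← integral_indicator_one measurableSet_Ioi, integral_empiricalLaw]
  have hB01 : ∀ s i ω, B s i ω ∈ Set.Icc (0 : ℝ) 1 := by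
    intro s i ω
    simp only [B, Set.indicator, Pi.one_apply]; split_ifs <;> simp
  have hBmean : ∀ s i, ∫ ω, B s i ω ∂P = ν.real (Set.Ioi s) := by
    intro s i
    rw [← hν i, ← integral_indicator_one measurableSet_Ioi, integral_map (hY i).aemeasurable
      (measurable_one.indicator measurableSet_Ioi).aestronglyMeasurable]
  have hνm : Measurable fun s : ℝ => ν.real (Set.Ioi s) :=
    Antitone.measurable fun s t h => measureReal_mono (Set.Ioi_subset_Ioi h)
  have hint : Integrable (Function.uncurry fun ω s =>
      |(n : ℝ)⁻¹ * ∑ i ∈ Finset.Icc 1 n, B s i ω - ν.real (Set.Ioi s)|)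
      (P.prod (volume.restrict (Set.Ioc (-U) U))) := by
    refine Integrable.of_bound (C := 1) ?_ (.of_forall fun p => ?_)
    · refine Measurable.aestronglyMeasurable ?_
      have h1 : ∀ i, Measurable fun p : Ω × ℝ => B p.2 i p.1 := fun i =>
        (measurable_pi_apply i).comp hBm
      simp only [Function.uncurry_def]
      have h2 : Measurable fun p : Ω × ℝ => ν.real (Set.Ioi p.2) := hνm.comp measurable_snd
      exact (((Finset.measurable_sum _ fun i _ => h1 i).const_mul _).sub h2).abs
    · have := isProbabilityMeasure_empiricalLaw hn fun i => Y i p.1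
      simp only [Function.uncurry, Real.norm_eq_abs, abs_abs, ← htail]
      rw [abs_le]
      constructor <;> linarith [measureReal_le_one (μ := ν) (s := Set.Ioi p.2),
        measureReal_le_one (μ := empiricalLaw n fun i => Y i p.1) (s := Set.Ioi p.2),
        measureReal_nonneg (μ := ν) (s := Set.Ioi p.2),
        measureReal_nonneg (μ := empiricalLaw n fun i => Y i p.1) (s := Set.Ioi p.2)]
  calc ∫ ω, |cvar α (empiricalLaw n fun i => Y i ω) - cvar α ν| ∂P
      ≤ ∫ ω, α⁻¹ * (∫ s in Set.Ioc (-U) U,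
          |(n : ℝ)⁻¹ * ∑ i ∈ Finset.Icc 1 n, B s i ω - ν.real (Set.Ioi s)|) ∂P := by
        refine integral_mono_of_nonneg (.of_forall fun _ => abs_nonneg _)
          (hint.integral_prod_left.const_mul _) (.of_forall fun ω => ?_)
        have := isProbabilityMeasure_empiricalLaw hn fun i => Y i ω
        have h := abs_cvar_sub_le_integral_tail (μ := empiricalLaw n fun i => Y i ω) hα hα1
          (ae_empiricalLaw fun i _ => hYU i ω) hνU
        simpa only [htail] using h
    _ = α⁻¹ * ∫ s in Set.Ioc (-U) U, (∫ ω,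
          |(n : ℝ)⁻¹ * ∑ i ∈ Finset.Icc 1 n, B s i ω - ν.real (Set.Ioi s)| ∂P) := by
        rw [integral_const_mul, integral_integral_swap hint]
    _ ≤ α⁻¹ * ∫ _ in Set.Ioc (-U) U, 1 / √(n : ℝ) := by
        refine mul_le_mul_of_nonneg_left ?_ (inv_nonneg.2 hα.le)
        refine integral_mono hint.integral_prod_right (integrable_const _) fun s => ?_
        refine integral_abs_mean_sub_le hn (fun i => ?_) (hB01 s) (fun i j hij => ?_) (hBmean s)
        · exact (measurable_one.indicator measurableSet_Ioi).comp (hY i)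
        · exact (hind hij).comp (measurable_one.indicator measurableSet_Ioi)
            (measurable_one.indicator measurableSet_Ioi)
    _ = 2 * U / α / √(n : ℝ) := by
        simp only [integral_const, smul_eq_mul, measureReal_restrict_apply_univ,
          Real.volume_real_Ioc]
        rw [max_eq_left (by linarith)]
        field_simp; ring

/-! ### The uniform law on the sphere -/

section Sphere

open scoped Pointwise

lemma isProbabilityMeasure_sphereUniform {d : ℕ} (hd : 1 ≤ d) :
    IsProbabilityMeasure (sphereUniform d) := by
  have : Nonempty (Fin d) := ⟨⟨0, hd⟩⟩
  constructor
  rw [sphereUniform, Measure.smul_apply, smul_eq_mul, ENNReal.inv_mul_cancel]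
  · exact fun h => Measure.toSphere_ne_zero (volume : Measure (Vec d))
      (Measure.measure_univ_eq_zero.1 h)
  · exact measure_ne_top _ _

/-- The action of a linear isometry on the unit sphere. -/
noncomputable def sphereMap {d : ℕ} (e : Vec d ≃ₗᵢ[ℝ] Vec d) (u : UnitSphere d) : UnitSphere d :=
  ⟨e u, by simp⟩

lemma continuous_sphereMap {d : ℕ} (e : Vec d ≃ₗᵢ[ℝ] Vec d) : Continuous (sphereMap e) :=
  (e.continuous.comp continuous_subtype_val).subtype_mk _

lemma map_sphereMap_toSphere {d : ℕ} (e : Vec d ≃ₗᵢ[ℝ] Vec d) :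
    (volume : Measure (Vec d)).toSphere.map (sphereMap e) =
      (volume : Measure (Vec d)).toSphere := by
  ext s hs
  have hm := (continuous_sphereMap e).measurable
  rw [Measure.map_apply hm hs, Measure.toSphere_apply' _ (hm hs), Measure.toSphere_apply' _ hs]
  congr 1
  have h : Set.Ioo (0 : ℝ) 1 • (Subtype.val '' (sphereMap e ⁻¹' s))
      = e ⁻¹' (Set.Ioo (0 : ℝ) 1 • (Subtype.val '' s)) := by
    ext x
    simp only [Set.mem_smul, Set.mem_image, Set.mem_preimage]
    constructor
    · rintro ⟨r, hr, _, ⟨y, hy, rfl⟩, rfl⟩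
      exact ⟨r, hr, _, ⟨_, hy, rfl⟩, by simp [sphereMap]⟩
    · rintro ⟨r, hr, _, ⟨y, hy, rfl⟩, hx⟩
      refine ⟨r, hr, e.symm y, ⟨sphereMap e.symm y, ?_, rfl⟩, ?_⟩
      · have : sphereMap e (sphereMap e.symm y) = y := by ext; simp [sphereMap]
        rwa [this]
      · rw [← map_smul, hx, e.symm_apply_apply]
  rw [h]
  exact e.measurePreserving.measure_preimage_emb e.toHomeomorph.measurableEmbedding _

lemma measurePreserving_sphereMap {d : ℕ} (e : Vec d ≃ₗᵢ[ℝ] Vec d) :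
    MeasurePreserving (sphereMap e) (sphereUniform d) (sphereUniform d) := by
  refine ⟨(continuous_sphereMap e).measurable, ?_⟩
  rw [sphereUniform, Measure.map_smul, map_sphereMap_toSphere]

lemma integral_sphereMap {d : ℕ} (e : Vec d ≃ₗᵢ[ℝ] Vec d) {f : UnitSphere d → ℝ}
    (hf : Continuous f) :
    ∫ u, f (sphereMap e u) ∂(sphereUniform d) = ∫ u, f u ∂(sphereUniform d) := by
  rw [← integral_map (φ := sphereMap e) (continuous_sphereMap e).aemeasurable
    hf.aestronglyMeasurable, (measurePreserving_sphereMap e).map_eq]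

lemma integrable_sphereUniform {d : ℕ} (hd : 1 ≤ d) {f : UnitSphere d → ℝ} (hf : Continuous f) :
    Integrable f (sphereUniform d) :=
  have := isProbabilityMeasure_sphereUniform hd
  hf.integrable_of_hasCompactSupport (HasCompactSupport.of_compactSpace f)

/-- Second moments of the uniform law on the sphere: by symmetry they depend on `‖w‖` only, and the
squares of the `d` coordinates add up to one. -/
lemma integral_inner_sq {d : ℕ} (hd : 1 ≤ d) (w : Vec d) :
    ∫ u, (inner ℝ (u : Vec d) w) ^ 2 ∂(sphereUniform d) = ‖w‖ ^ 2 / d := by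
  have := isProbabilityMeasure_sphereUniform hd
  have hsymm : ∀ w' : Vec d, ‖w‖ = ‖w'‖ → ∫ u, (inner ℝ (u : Vec d) w) ^ 2 ∂(sphereUniform d)
      = ∫ u, (inner ℝ (u : Vec d) w') ^ 2 ∂(sphereUniform d) := by
    intro w' h
    let e : Vec d ≃ₗᵢ[ℝ] Vec d := (Submodule.span ℝ {w - w'})ᗮ.reflection
    have he : e w = w' := Submodule.reflection_sub h
    rw [← integral_sphereMap e (f := fun u => (inner ℝ (u : Vec d) w') ^ 2) (by fun_prop)]
    simp only [sphereMap, ← he, LinearIsometryEquiv.inner_map_map]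
  have hcoord : ∀ i : Fin d, ∫ u, (inner ℝ (u : Vec d) w) ^ 2 ∂(sphereUniform d)
      = ‖w‖ ^ 2 * ∫ u, ((u : Vec d) i) ^ 2 ∂(sphereUniform d) := by
    intro i
    rw [hsymm (EuclideanSpace.single i ‖w‖) (by simp), ← integral_const_mul]
    simp [EuclideanSpace.inner_single_right, mul_pow]
  have hsum : ∑ i : Fin d, ∫ u, ((u : Vec d) i) ^ 2 ∂(sphereUniform d) = 1 := by
    rw [← integral_finsetSum _ fun i _ => integrable_sphereUniform hd (by fun_prop)]
    have : ∀ u : UnitSphere d, ∑ i, ((u : Vec d) i) ^ 2 = 1 := by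
      intro u
      rw [← EuclideanSpace.real_norm_sq_eq, norm_eq_of_mem_sphere u, one_pow]
    simp [this]
  have hd0 : (d : ℝ) ≠ 0 := by positivity
  have : (d : ℝ) * ∫ u, (inner ℝ (u : Vec d) w) ^ 2 ∂(sphereUniform d) = ‖w‖ ^ 2 := by
    calc (d : ℝ) * ∫ u, (inner ℝ (u : Vec d) w) ^ 2 ∂(sphereUniform d)
        = ∑ i : Fin d, ∫ u, (inner ℝ (u : Vec d) w) ^ 2 ∂(sphereUniform d) := by simp
      _ = ‖w‖ ^ 2 * ∑ i : Fin d, ∫ u, ((u : Vec d) i) ^ 2 ∂(sphereUniform d) := by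
        rw [Finset.mul_sum]; exact Finset.sum_congr rfl fun i _ => hcoord i
      _ = ‖w‖ ^ 2 := by rw [hsum, mul_one]
  field_simp
  linarith

end Sphere

/-! ### The one-point gradient estimate of a convex function -/

/-- Slopes of a convex function along the direction `w` increase: the slope of the chord from `p` to
`p + l w` is at least the increment over the step of length `w` that ends at `p`. -/
lemma mul_sub_le_of_convexOn {E : Type*} [AddCommGroup E] [Module ℝ E] {X : Set E} {f : E → ℝ}
    (hf : ConvexOn ℝ X f) {p w : E} {l : ℝ} (hl : 0 ≤ l) (h1 : p - w ∈ X) (h2 : p + l • w ∈ X) :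
    l * (f p - f (p - w)) ≤ f (p + l • w) - f p := by
  have hl' : 0 < 1 + l := by linarith
  have hsum : l / (1 + l) + 1 / (1 + l) = 1 := by field_simp; ring
  have h := hf.2 h1 h2 (by positivity) (by positivity) hsum
  have e : (l / (1 + l)) • (p - w) + (1 / (1 + l)) • (p + l • w) = p := by
    have h3 : p = (l / (1 + l) + 1 / (1 + l)) • p := by
      rw [hsum, one_smul]
    nth_rw 3 [h3]
    module
  rw [e, smul_eq_mul, smul_eq_mul, div_mul_eq_mul_div, div_mul_eq_mul_div, ← add_div,
    le_div_iff₀ hl'] at h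
  linarith

/-- The one-point estimate `(d/δ) f(x + δ u) u` acts in mean like a subgradient of the convex
function `f` at `x`, up to an error of order `δ`. The proof pairs each direction `u` with its mirror
image in the hyperplane orthogonal to `x - y`; the two points `x + δ u` lie on a line parallel to
`x - y`, along which the slopes of `f` increase. -/
lemma sub_le_integral_gradEst {d : ℕ} (hd : 1 ≤ d) {X : Set (Vec d)} {f : Vec d → ℝ} {M δ : ℝ}
    (hM : 0 ≤ M) (hδ : 0 < δ) (hf : ConvexOn ℝ X f)
    (hL : ∀ x ∈ X, ∀ y ∈ X, |f x - f y| ≤ M * ‖x - y‖) {x y : Vec d}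
    (hx : ∀ u : UnitSphere d, x + δ • (u : Vec d) ∈ X)
    (hy : ∀ u : UnitSphere d, y + δ • (u : Vec d) ∈ X) (hxX : x ∈ X) (hyX : y ∈ X) :
    f x - f y - 2 * M * δ ≤
      (d : ℝ) / δ *
        ∫ u, f (x + δ • (u : Vec d)) * inner ℝ (u : Vec d) (x - y) ∂(sphereUniform d) := by
  have := isProbabilityMeasure_sphereUniform hd
  have hd0 : (0 : ℝ) < d := by exact_mod_cast hd
  rcases eq_or_ne x y with rfl | hxy
  · simp; positivity
  set w := x - y with hw
  have hw0 : 0 < ‖w‖ := norm_pos_iff.2 (sub_ne_zero.2 hxy)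
  have hcont : Continuous fun u : UnitSphere d => f (x + δ • (u : Vec d)) := by
    have hfX : ContinuousOn f X :=
      (LipschitzOnWith.of_dist_le_mul (K := ⟨M, hM⟩) fun a ha b hb => by
        rw [Real.dist_eq, dist_eq_norm]; exact hL a ha b hb).continuousOn
    exact hfX.comp_continuous (by fun_prop) hx
  have hh : Continuous fun u : UnitSphere d =>
      f (x + δ • (u : Vec d)) * inner ℝ (u : Vec d) w := hcont.mul (by fun_prop)
  let R : Vec d ≃ₗᵢ[ℝ] Vec d := (Submodule.span ℝ {w})ᗮ.reflection
  have hRw : R w = -w := Submodule.reflection_orthogonalComplement_singleton_eq_neg w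
  have hRu : ∀ u : Vec d, R u = u - (2 * inner ℝ u w / ‖w‖ ^ 2) • w := by
    intro u
    have : R u = -(Submodule.span ℝ {w}).reflection u := Submodule.reflection_orthogonal_apply ..
    rw [this, Submodule.reflection_singleton_apply, real_inner_comm]
    simp only [RCLike.ofReal_real_eq_id, id]
    module
  have hRi : ∀ u : Vec d, inner ℝ (R u) w = -inner ℝ u w := by
    intro u
    rw [← R.inner_map_map u w, hRw, inner_neg_right, neg_neg]
  set g := f x - f y - 2 * M * δ with hg
  have hstep : ∀ u : UnitSphere d, g ≤ f (x + δ • (u : Vec d)) - f (x + δ • (u : Vec d) - w) := by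
    intro u
    have e : x + δ • (u : Vec d) - w = y + δ • (u : Vec d) := by rw [hw]; abel
    have hn : ‖δ • (u : Vec d)‖ = δ := by
      rw [norm_smul, norm_eq_of_mem_sphere u, mul_one, Real.norm_of_nonneg hδ.le]
    have h1 := hL _ hxX _ (hx u)
    have h2 := hL _ (hy u) _ hyX
    rw [sub_add_cancel_left, norm_neg, hn] at h1
    rw [add_sub_cancel_left, hn] at h2
    rw [e]
    linarith [(abs_le.1 h1).2, (abs_le.1 h2).2]
  have hpair : ∀ u : UnitSphere d, 2 * δ / ‖w‖ ^ 2 * g * inner ℝ (u : Vec d) w ^ 2 ≤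
      f (x + δ • (u : Vec d)) * inner ℝ (u : Vec d) w +
        f (x + δ • (sphereMap R u : Vec d)) * inner ℝ (sphereMap R u : Vec d) w := by
    intro u
    have hRuX := hx (sphereMap R u)
    have hstepR := hstep (sphereMap R u)
    have hyu : ∀ u : UnitSphere d, x + δ • (u : Vec d) - w ∈ X := fun u => by
      convert hy u using 1; rw [hw]; abel
    have hyR := hyu (sphereMap R u)
    have hi : inner ℝ (sphereMap R u : Vec d) w = -inner ℝ (u : Vec d) w := hRi u
    rw [hi]
    set s : ℝ := inner ℝ (u : Vec d) w with hs
    set p := x + δ • (u : Vec d) with hp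
    set p' := x + δ • (sphereMap R u : Vec d) with hp'
    have hpp : p' = p - (2 * δ / ‖w‖ ^ 2 * s) • w := by
      have : (sphereMap R u : Vec d) = u - (2 * s / ‖w‖ ^ 2) • w := hRu u
      rw [hp', hp, this]
      module
    set k := 2 * δ / ‖w‖ ^ 2 with hk
    have hk0 : 0 < k := by positivity
    rcases le_total 0 s with h | h
    · have hl : 0 ≤ k * s := mul_nonneg hk0.le h
      have e : p' + (k * s) • w = p := by rw [hpp]; abel
      have := mul_sub_le_of_convexOn hf hl hyR (by rw [e]; exact hx u)
      rw [e] at this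
      have h2 := mul_le_mul_of_nonneg_left hstepR hl
      nlinarith
    · have hl : 0 ≤ -(k * s) := neg_nonneg.2 (mul_nonpos_of_nonneg_of_nonpos hk0.le h)
      have e : p + (-(k * s)) • w = p' := by rw [hpp]; module
      have := mul_sub_le_of_convexOn hf hl (hyu u) (by rw [e]; exact hRuX)
      rw [e] at this
      have h2 := mul_le_mul_of_nonneg_left (hstep u) hl
      nlinarith
  have hint : 2 * δ / ‖w‖ ^ 2 * g * (‖w‖ ^ 2 / d) ≤
      2 * ∫ u, f (x + δ • (u : Vec d)) * inner ℝ (u : Vec d) w ∂(sphereUniform d) := by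
    rw [← integral_inner_sq hd, ← integral_const_mul,
      two_mul (∫ u, _ ∂(sphereUniform d))]
    nth_rw 2 [← integral_sphereMap R hh]
    have hh' : Continuous fun u : UnitSphere d =>
        f (x + δ • (sphereMap R u : Vec d)) * inner ℝ (sphereMap R u : Vec d) w :=
      hh.comp (continuous_sphereMap R)
    rw [← integral_add (integrable_sphereUniform hd hh) (integrable_sphereUniform hd hh')]
    exact integral_mono (integrable_sphereUniform hd (by fun_prop))
      ((integrable_sphereUniform hd hh).add (integrable_sphereUniform hd hh')) hpair
  have e : 2 * δ / ‖w‖ ^ 2 * g * (‖w‖ ^ 2 / d) = 2 * (δ / d * g) := by field_simp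
  rw [e] at hint
  have h3 : (d : ℝ) / δ * (δ / d * g) = g := by field_simp
  rw [← h3]
  exact mul_le_mul_of_nonneg_left (by linarith) (by positivity)

/-! ### The risk-averse cost -/

/-- The standing assumptions on a cost on the feasible set `X`: it is bounded by `U`, convex in the
action, and Lipschitz with constant `L₀` in the action and in the noise. -/
structure IsRegularCost {d : ℕ} {Ξ : Type*} [PseudoMetricSpace Ξ] (X : Set (Vec d))
    (J : Vec d → Ξ → ℝ) (U L₀ : ℝ) : Prop where
  bound : ∀ x ∈ X, ∀ z, |J x z| ≤ U
  convex : ∀ z, ConvexOn ℝ X fun x => J x z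
  lipschitz_action : ∀ z, ∀ x ∈ X, ∀ y ∈ X, |J x z - J y z| ≤ L₀ * ‖x - y‖
  lipschitz_noise : ∀ x ∈ X, ∀ z w, |J x z - J x w| ≤ L₀ * dist z w

lemma integral_sub_le_wasserstein {Ξ : Type*} [PseudoEMetricSpace Ξ] [MeasurableSpace Ξ]
    {D D' : Measure Ξ} (hW : wasserstein D D' ≠ ⊤) {f : Ξ → ℝ}
    (hf : LipschitzWith 1 f) (h1 : Integrable f D) (h2 : Integrable f D') :
    ∫ z, f z ∂D - ∫ z, f z ∂D' ≤ (wasserstein D D').toReal := by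
  rw [← ENNReal.ofReal_le_iff_le_toReal hW]
  exact le_iSup_of_le f (le_iSup_of_le hf (le_iSup_of_le h1 (le_iSup_of_le h2 le_rfl)))

section RiskCost

variable {d : ℕ} {Ξ : Type*} [PseudoMetricSpace Ξ] [MeasurableSpace Ξ] [BorelSpace Ξ]
  {X : Set (Vec d)} {J : Vec d → Ξ → ℝ} {U L₀ α : ℝ}

lemma IsRegularCost.measurable (hJ : IsRegularCost X J U L₀) (hL : 0 ≤ L₀) {x : Vec d}
    (hx : x ∈ X) : Measurable (J x) := by
  refine (LipschitzWith.of_dist_le_mul (K := ⟨L₀, hL⟩) fun z w => ?_).continuous.measurable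
  rw [Real.dist_eq]
  exact hJ.lipschitz_noise x hx z w

variable {D D' : Measure Ξ}

lemma ae_map_cost (hJ : IsRegularCost X J U L₀) (hL : 0 ≤ L₀) {x : Vec d} (hx : x ∈ X) :
    ∀ᵐ y ∂(D.map (J x)), |y| ≤ U := by
  rw [ae_map_iff (hJ.measurable hL hx).aemeasurable
    (measurableSet_le (by fun_prop) (by fun_prop))]
  exact .of_forall (hJ.bound x hx)

lemma integral_excess_cost (hJ : IsRegularCost X J U L₀) (hL : 0 ≤ L₀) {x : Vec d} (hx : x ∈ X)
    (v : ℝ) : ∫ y, max (y - v) 0 ∂(D.map (J x)) = ∫ z, max (J x z - v) 0 ∂D :=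
  integral_map (hJ.measurable hL hx).aemeasurable (by fun_prop)

lemma exists_lt_riskCost_add (hJ : IsRegularCost X J U L₀) (hL : 0 ≤ L₀) {x : Vec d} (hx : x ∈ X)
    {ε : ℝ} (hε : 0 < ε) :
    ∃ v, v + α⁻¹ * ∫ z, max (J x z - v) 0 ∂D < riskCost J α D x + ε := by
  obtain ⟨v, hv⟩ := exists_lt_of_ciInf_lt (lt_add_of_pos_right (riskCost J α D x) hε)
  exact ⟨v, by rwa [integral_excess_cost hJ hL hx] at hv⟩

variable [IsProbabilityMeasure D]

lemma isProbabilityMeasure_map_cost (hJ : IsRegularCost X J U L₀) (hL : 0 ≤ L₀) {x : Vec d}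
    (hx : x ∈ X) : IsProbabilityMeasure (D.map (J x)) :=
  Measure.isProbabilityMeasure_map (hJ.measurable hL hx).aemeasurable

lemma integrable_excess_cost (hJ : IsRegularCost X J U L₀) (hL : 0 ≤ L₀) {x : Vec d} (hx : x ∈ X)
    (v : ℝ) : Integrable (fun z => max (J x z - v) 0) D := by
  have : Integrable (J x) D := Integrable.of_bound (hJ.measurable hL hx).aestronglyMeasurable U
    (.of_forall (hJ.bound x hx))
  exact (this.sub (integrable_const v)).pos_part

lemma riskCost_le (hJ : IsRegularCost X J U L₀) (hL : 0 ≤ L₀) (hα : 0 < α) (hα1 : α ≤ 1)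
    {x : Vec d} (hx : x ∈ X) (v : ℝ) :
    riskCost J α D x ≤ v + α⁻¹ * ∫ z, max (J x z - v) 0 ∂D := by
  have := isProbabilityMeasure_map_cost (D := D) hJ hL hx
  rw [← integral_excess_cost hJ hL hx]
  exact ciInf_le (bddBelow_cvar_objective hα hα1 (ae_map_cost hJ hL hx)) v

lemma riskCost_le_add (hJ : IsRegularCost X J U L₀) (hL : 0 ≤ L₀) (hα : 0 < α) (hα1 : α ≤ 1)
    {x y : Vec d} (hx : x ∈ X) (hy : y ∈ X) {ε : ℝ}
    (h : ∀ v, ∫ z, max (J x z - v) 0 ∂D ≤ ∫ z, max (J y z - v) 0 ∂D' + ε) :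
    riskCost J α D x ≤ riskCost J α D' y + α⁻¹ * ε := by
  have := isProbabilityMeasure_map_cost (D := D) hJ hL hx
  refine cvar_le_add hα hα1 (ae_map_cost hJ hL hx) fun v => ?_
  rw [integral_excess_cost hJ hL hx, integral_excess_cost hJ hL hy]
  exact h v

lemma riskCost_lipschitz (hJ : IsRegularCost X J U L₀) (hL : 0 ≤ L₀) (hα : 0 < α) (hα1 : α ≤ 1)
    {x y : Vec d} (hx : x ∈ X) (hy : y ∈ X) :
    |riskCost J α D x - riskCost J α D y| ≤ L₀ / α * ‖x - y‖ := by
  have key : ∀ x ∈ X, ∀ y ∈ X,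
      riskCost J α D x ≤ riskCost J α D y + α⁻¹ * (L₀ * ‖x - y‖) := by
    intro x hx y hy
    refine riskCost_le_add hJ hL hα hα1 hx hy fun v => ?_
    calc ∫ z, max (J x z - v) 0 ∂D ≤ ∫ z, (max (J y z - v) 0 + L₀ * ‖x - y‖) ∂D := by
          refine integral_mono (integrable_excess_cost hJ hL hx v)
            ((integrable_excess_cost hJ hL hy v).add (integrable_const _)) fun z => ?_
          have h1 := le_of_abs_le (hJ.lipschitz_action z x hx y hy)
          have h2 : 0 ≤ L₀ * ‖x - y‖ := by positivity
          exact max_le (by linarith [le_max_left (J y z - v) 0])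
            (by linarith [le_max_right (J y z - v) 0])
      _ = _ := by
          rw [integral_add (integrable_excess_cost hJ hL hy v) (integrable_const _)]
          simp
  have h1 := key x hx y hy
  have h2 := key y hy x hx
  rw [norm_sub_rev] at h2
  rw [div_eq_inv_mul, mul_assoc]
  exact abs_le.2 ⟨by linarith, by linarith⟩

lemma convexOn_riskCost (hX : Convex ℝ X) (hJ : IsRegularCost X J U L₀) (hL : 0 ≤ L₀) (hα : 0 < α)
    (hα1 : α ≤ 1) : ConvexOn ℝ X (riskCost J α D) := by
  refine ⟨hX, fun x hx y hy a b ha hb hab => le_of_forall_pos_le_add fun ε hε => ?_⟩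
  obtain ⟨v, hv⟩ := exists_lt_riskCost_add (D := D) (α := α) hJ hL hx hε
  obtain ⟨v', hv'⟩ := exists_lt_riskCost_add (D := D) (α := α) hJ hL hy hε
  have h := riskCost_le (D := D) hJ hL hα hα1 (hX hx hy ha hb hab) (a * v + b * v')
  have hle : ∫ z, max (J (a • x + b • y) z - (a * v + b * v')) 0 ∂D ≤
      a * ∫ z, max (J x z - v) 0 ∂D + b * ∫ z, max (J y z - v') 0 ∂D := by
    have h1 := (integrable_excess_cost (D := D) hJ hL hx v).const_mul a
    have h2 := (integrable_excess_cost (D := D) hJ hL hy v').const_mul b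
    rw [← integral_const_mul, ← integral_const_mul, ← integral_add h1 h2]
    refine integral_mono (integrable_excess_cost hJ hL (hX hx hy ha hb hab) _) (h1.add h2)
      fun z => ?_
    have h3 := (hJ.convex z).2 hx hy ha hb hab
    simp only [smul_eq_mul] at h3
    have h4 := mul_le_mul_of_nonneg_left (le_max_left (J x z - v) 0) ha
    have h5 := mul_le_mul_of_nonneg_left (le_max_left (J y z - v') 0) hb
    have h6 := mul_nonneg ha (le_max_right (J x z - v) 0)
    have h7 := mul_nonneg hb (le_max_right (J y z - v') 0)
    exact max_le (by linarith) (by linarith)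
  have hle' := mul_le_mul_of_nonneg_left hle (inv_nonneg.2 hα.le)
  have h1 := mul_le_mul_of_nonneg_left hv.le ha
  have h2 := mul_le_mul_of_nonneg_left hv'.le hb
  have h3 : a * ε + b * ε = ε := by rw [← add_mul, hab, one_mul]
  simp only [smul_eq_mul]
  linarith

/-- A change of the noise distribution changes the risk-averse cost by at most a multiple of the
Wasserstein distance, since the excess of the cost over any level is Lipschitz in the noise. -/
lemma abs_riskCost_sub_le_wasserstein [IsProbabilityMeasure D'] (hJ : IsRegularCost X J U L₀)
    (hL : 0 < L₀) (hα : 0 < α) (hα1 : α ≤ 1) (hW : wasserstein D D' ≠ ⊤) {x : Vec d} (hx : x ∈ X) :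
    |riskCost J α D x - riskCost J α D' x| ≤ L₀ / α * (wasserstein D D').toReal := by
  have hlip : ∀ v, LipschitzWith 1 fun z => L₀⁻¹ * max (J x z - v) 0 := fun v => by
    refine LipschitzWith.of_dist_le_mul fun z w => ?_
    have h1 := abs_max_sub_max_le_abs (J x z - v) (J x w - v) 0
    have h2 := hJ.lipschitz_noise x hx z w
    rw [sub_sub_sub_cancel_right] at h1
    rw [Real.dist_eq, ← mul_sub, abs_mul, abs_of_pos (inv_pos.2 hL), NNReal.coe_one, one_mul,
      inv_mul_le_iff₀ hL]
    exact h1.trans h2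
  have hint : ∀ (E : Measure Ξ) [IsProbabilityMeasure E] (v : ℝ),
      Integrable (fun z => L₀⁻¹ * max (J x z - v) 0) E := fun E _ v =>
    (integrable_excess_cost hJ hL.le hx v).const_mul _
  have key1 : ∀ v, ∫ z, max (J x z - v) 0 ∂D ≤
      ∫ z, max (J x z - v) 0 ∂D' + L₀ * (wasserstein D D').toReal := fun v => by
    have h := integral_sub_le_wasserstein hW (hlip v) (hint D v) (hint D' v)
    rw [integral_const_mul, integral_const_mul, ← mul_sub, inv_mul_le_iff₀ hL] at h
    linarith
  have key2 : ∀ v, ∫ z, max (J x z - v) 0 ∂D' ≤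
      ∫ z, max (J x z - v) 0 ∂D + L₀ * (wasserstein D D').toReal := fun v => by
    have h := integral_sub_le_wasserstein hW (hlip v).neg (hint D v).neg (hint D' v).neg
    simp only [Pi.neg_apply, integral_neg, integral_const_mul] at h
    rw [neg_sub_neg, ← mul_sub, inv_mul_le_iff₀ hL] at h
    linarith
  have h1 := riskCost_le_add hJ hL.le hα hα1 hx hx key1
  have h2 := riskCost_le_add hJ hL.le hα hα1 hx hx key2
  rw [div_eq_inv_mul, mul_assoc]
  exact abs_le.2 ⟨by linarith, by linarith⟩

end RiskCost

/-! ### The shrunk feasible set and Euclidean projection -/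

section Projection

variable {d : ℕ} {X S : Set (Vec d)} {r δ : ℝ}

lemma convex_shrunkSet (hX : Convex ℝ X) : Convex ℝ (shrunkSet X r δ) :=
  hX.inter (hX.smul_preimage _)

lemma isClosed_shrunkSet (hX : IsClosed X) : IsClosed (shrunkSet X r δ) :=
  hX.inter (hX.preimage (continuous_const_smul _))

lemma add_smul_mem_of_mem_shrunkSet (hX : Convex ℝ X) (hball : Metric.closedBall 0 r ⊆ X)
    (hδ : 0 < δ) (hδr : δ < r) {x : Vec d} (hx : x ∈ shrunkSet X r δ) (u : UnitSphere d) :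
    x + δ • (u : Vec d) ∈ X := by
  have hr : 0 < r := hδ.trans hδr
  have h1 : δ / r < 1 := (div_lt_one hr).2 hδr
  have hu : r • (u : Vec d) ∈ X := hball (by
    rw [mem_closedBall_zero_iff, norm_smul, norm_eq_of_mem_sphere u, Real.norm_of_nonneg hr.le,
      mul_one])
  have := hX hx.2 hu (a := 1 - δ / r) (b := δ / r) (by linarith) (by positivity) (by ring)
  rwa [smul_smul, smul_smul, mul_one_div_cancel (by linarith : (1 - δ / r) ≠ 0), one_smul,
    div_mul_cancel₀ _ hr.ne'] at this

lemma smul_mem_shrunkSet (hX : Convex ℝ X) (h0 : (0 : Vec d) ∈ X) (hδ : 0 < δ) (hδr : δ < r)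
    {p : Vec d} (hp : p ∈ X) : (1 - δ / r) • p ∈ shrunkSet X r δ := by
  have hr : 0 < r := hδ.trans hδr
  have h1 : δ / r < 1 := (div_lt_one hr).2 hδr
  have h2 : 0 < δ / r := by positivity
  refine ⟨hX.smul_mem_of_zero_mem h0 hp ⟨by linarith, by linarith⟩, ?_⟩
  rwa [smul_smul, one_div_mul_cancel (by linarith), one_smul]

/-- Existence and variational characterization of the nearest point. -/
lemma proj_spec (hne : S.Nonempty) (hS : Convex ℝ S) (hc : IsClosed S) (x : Vec d) :
    proj S x ∈ S ∧ ∀ w ∈ S, inner ℝ (x - proj S x) (w - proj S x) ≤ 0 := by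
  have hex : ∃ y, y ∈ S ∧ ∀ w ∈ S, ‖x - y‖ ^ 2 ≤ ‖x - w‖ ^ 2 := by
    obtain ⟨y, hy, h⟩ := exists_norm_eq_iInf_of_complete_convex hne hc.isComplete hS x
    refine ⟨y, hy, fun w hw => pow_le_pow_left₀ (norm_nonneg _) ?_ 2⟩
    rw [h]
    exact ciInf_le ⟨0, by rintro _ ⟨_, rfl⟩; exact norm_nonneg _⟩ (⟨w, hw⟩ : S)
  obtain ⟨h1, h2⟩ : proj S x ∈ S ∧ ∀ w ∈ S, ‖x - proj S x‖ ^ 2 ≤ ‖x - w‖ ^ 2 :=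
    Classical.epsilon_spec hex
  refine ⟨h1, (norm_eq_iInf_iff_real_inner_le_zero hS h1).1 ?_⟩
  have : Nonempty S := hne.to_subtype
  refine le_antisymm (le_ciInf fun w => ?_) ?_
  · exact (pow_le_pow_iff_left₀ (norm_nonneg _) (norm_nonneg _) two_ne_zero).1 (h2 w w.2)
  · exact ciInf_le ⟨0, by rintro _ ⟨_, rfl⟩; exact norm_nonneg _⟩ (⟨_, h1⟩ : S)

lemma norm_proj_sub_le (hS : Convex ℝ S) (hc : IsClosed S) {y : Vec d} (hy : y ∈ S) (x : Vec d) :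
    ‖proj S x - y‖ ^ 2 ≤ ‖x - y‖ ^ 2 := by
  have h := (proj_spec ⟨y, hy⟩ hS hc x).2 y hy
  have e := norm_sub_sq_real (x - proj S x) (y - proj S x)
  rw [sub_sub_sub_cancel_right] at e
  rw [e, norm_sub_rev (proj S x)]
  nlinarith [sq_nonneg ‖x - proj S x‖]

lemma continuous_proj (hne : S.Nonempty) (hS : Convex ℝ S) (hc : IsClosed S) :
    Continuous (proj S) := by
  refine (LipschitzWith.of_dist_le_mul (K := 1) fun x y => ?_).continuous
  obtain ⟨hx, hx'⟩ := proj_spec hne hS hc x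
  obtain ⟨hy, hy'⟩ := proj_spec hne hS hc y
  have h1 := hx' _ hy
  have h2 := hy' _ hx
  set p := proj S x
  set q := proj S y
  have h3 : ‖p - q‖ ^ 2 ≤ inner ℝ (x - y) (p - q) := by
    have e : inner ℝ (x - y) (p - q) - ‖p - q‖ ^ 2
        = -inner ℝ (x - p) (q - p) - inner ℝ (y - q) (p - q) := by
      rw [← real_inner_self_eq_norm_sq, ← inner_sub_left, ← inner_neg_right, neg_sub,
        ← inner_sub_left]
      congr 1; abel
    linarith
  have h4 : inner ℝ (x - y) (p - q) ≤ ‖x - y‖ * ‖p - q‖ := real_inner_le_norm _ _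
  rw [NNReal.coe_one, one_mul, dist_eq_norm, dist_eq_norm]
  rcases (norm_nonneg (p - q)).eq_or_lt with h | h
  · rw [← h]; exact norm_nonneg _
  · nlinarith

lemma proj_eq_self (hS : Convex ℝ S) (hc : IsClosed S) {x : Vec d} (hx : x ∈ S) :
    proj S x = x := by
  have h := norm_proj_sub_le hS hc hx x
  rw [sub_self, norm_zero] at h
  have : ‖proj S x - x‖ = 0 := by nlinarith [norm_nonneg (proj S x - x)]
  exact sub_eq_zero.1 (norm_eq_zero.1 this)

/-- One step of projected gradient descent. -/
lemma inner_le_of_proj_step (hS : Convex ℝ S) (hc : IsClosed S) {η : ℝ} (hη : 0 < η) {y : Vec d}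
    (hy : y ∈ S) (x g : Vec d) :
    inner ℝ g (x - y) ≤
      (‖x - y‖ ^ 2 - ‖proj S (x - η • g) - y‖ ^ 2) / (2 * η) + η / 2 * ‖g‖ ^ 2 := by
  have h := norm_proj_sub_le hS hc hy (x - η • g)
  have e : ‖x - η • g - y‖ ^ 2 = ‖x - y‖ ^ 2 - 2 * η * inner ℝ g (x - y) + η ^ 2 * ‖g‖ ^ 2 := by
    rw [show x - η • g - y = (x - y) - η • g by abel, norm_sub_sq_real, real_inner_smul_right,
      norm_smul, Real.norm_of_nonneg hη.le, real_inner_comm]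
    ring
  rw [e] at h
  have : inner ℝ g (x - y) ≤
      (‖x - y‖ ^ 2 - ‖proj S (x - η • g) - y‖ ^ 2 + η ^ 2 * ‖g‖ ^ 2) / (2 * η) := by
    rw [le_div_iff₀ (by positivity)]; linarith
  refine this.trans (le_of_eq ?_)
  field_simp

end Projection

/-! ### Concentration for sums adapted to independent rounds -/

section Concentration

variable {Ω : Type*} [mΩ : MeasurableSpace Ω] {P : Measure Ω}

/-- The σ-algebra of the random inputs `w s` of the rounds `s < t`. -/
abbrev past {Ω W : Type*} [MeasurableSpace W] (w : ℕ → Ω → W) (t : ℕ) : MeasurableSpace Ω :=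
  ⨆ s ∈ Set.Iio t, MeasurableSpace.comap (w s) inferInstance

lemma past_mono {Ω W : Type*} [MeasurableSpace W] (w : ℕ → Ω → W) : Monotone (past w) :=
  fun _ _ h => biSup_mono fun _ hs => lt_of_lt_of_le hs h

lemma past_le {W : Type*} [MeasurableSpace W] {w : ℕ → Ω → W} (hw : ∀ t, Measurable (w t))
    (t : ℕ) : past w t ≤ mΩ :=
  iSup₂_le fun s _ => (hw s).comap_le

lemma measurable_past {Ω W : Type*} [MeasurableSpace W] (w : ℕ → Ω → W) {s t : ℕ} (h : s < t) :
    Measurable[past w t] (w s) :=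
  measurable_iff_comap_le.2 (le_iSup₂_of_le (f := fun s (_ : s ∈ Set.Iio t) =>
    MeasurableSpace.comap (w s) inferInstance) s h le_rfl)

variable [IsProbabilityMeasure P]

/-- If `w` is independent of `(S, x)`, adding the centred bounded variable `E h(x, w) - h(x, w)` to
the sub-Gaussian variable `S` adds the variance proxies: conditionally on `(S, x)`, that is, by
Fubini's theorem for the product law, this is Hoeffding's lemma. -/
lemma hasSubgaussianMGF_add_of_indep {W E : Type*} [MeasurableSpace W] [MeasurableSpace E]
    {w : Ω → W} (hw : Measurable w) {S : Ω → ℝ} {x : Ω → E} (hS : Measurable S) (hx : Measurable x)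
    (hind : IndepFun (fun ω => (S ω, x ω)) w P) {h : E × W → ℝ} (hh : Measurable h) {B c : NNReal}
    (hB : ∀ p, |h p| ≤ B) {C : ℝ} (hSC : ∀ ω, |S ω| ≤ C) (hc : HasSubgaussianMGF S c P) :
    HasSubgaussianMGF (fun ω => S ω + (∫ ω', h (x ω, w ω') ∂P - h (x ω, w ω))) (c + B ^ 2) P := by
  let M : E → ℝ := fun y => ∫ ω', h (y, w ω') ∂P
  have hhw : ∀ y, Measurable fun ω' => h (y, w ω') := fun y => by fun_prop
  have hM : Measurable M := by
    have h1 : Measurable fun p : E × Ω => h (p.1, w p.2) := by fun_prop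
    exact h1.stronglyMeasurable.integral_prod_right'.measurable
  have hMB : ∀ y, |M y| ≤ B := fun y => by
    have := norm_integral_le_of_norm_le_const (μ := P) (f := fun ω' => h (y, w ω')) (C := B)
      (.of_forall fun ω' => hB _)
    simpa using this
  have hZm : Measurable fun ω => S ω + (M (x ω) - h (x ω, w ω)) := by fun_prop
  have hint : ∀ t : ℝ, Integrable (fun ω => Real.exp (t * (S ω + (M (x ω) - h (x ω, w ω))))) P := by
    intro t
    refine Integrable.of_bound (hZm.const_mul t).exp.aestronglyMeasurable
      (Real.exp (|t| * (C + (B + B)))) (.of_forall fun ω => ?_)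
    rw [Real.norm_of_nonneg (Real.exp_pos _).le, Real.exp_le_exp]
    refine (le_abs_self _).trans ?_
    rw [abs_mul]
    refine mul_le_mul_of_nonneg_left ((abs_add_le _ _).trans ?_) (abs_nonneg _)
    exact add_le_add (hSC ω) ((abs_sub _ _).trans (add_le_add (hMB _) (hB _)))
  refine ⟨hint, fun t => ?_⟩
  have hgauss : ∀ y, mgf (fun ω' => M y - h (y, w ω')) P t ≤ Real.exp (B ^ 2 * t ^ 2 / 2) := by
    intro y
    have h1 := (hasSubgaussianMGF_of_mem_Icc (μ := P) (X := fun ω' => h (y, w ω'))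
      (a := -(B : ℝ)) (b := B) (hhw y).aemeasurable
      (.of_forall fun ω' => abs_le.1 (hB _))).neg.mgf_le t
    have h2 : (-fun ω' => h (y, w ω') - ∫ ω', h (y, w ω') ∂P) = fun ω' => M y - h (y, w ω') := by
      ext ω'; simp [M]
    rw [h2] at h1
    refine h1.trans (le_of_eq ?_)
    congr 4
    rw [sub_neg_eq_add, NNReal.coe_pow, NNReal.coe_div, coe_nnnorm,
      Real.norm_of_nonneg (by positivity)]
    norm_num
  have hpair : P.map (fun ω => ((S ω, x ω), w ω)) = (P.map fun ω => (S ω, x ω)).prod (P.map w) :=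
    (indepFun_iff_map_prod_eq_prod_map_map (by fun_prop) hw.aemeasurable).1 hind
  let F : (ℝ × E) × W → ℝ := fun p => Real.exp (t * (p.1.1 + (M p.1.2 - h (p.1.2, p.2))))
  have hF : Measurable F := by fun_prop
  have hFint : Integrable F ((P.map fun ω => (S ω, x ω)).prod (P.map w)) := by
    rw [← hpair, integrable_map_measure hF.aestronglyMeasurable (by fun_prop)]
    exact hint t
  have := Measure.isProbabilityMeasure_map (μ := P) hw.aemeasurable
  calc mgf (fun ω => S ω + (M (x ω) - h (x ω, w ω))) P t
      = ∫ p, F p ∂(P.map fun ω => ((S ω, x ω), w ω)) := by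
        rw [integral_map (by fun_prop) hF.aestronglyMeasurable]; rfl
    _ = ∫ q, ∫ v, F (q, v) ∂(P.map w) ∂(P.map fun ω => (S ω, x ω)) := by
        rw [hpair, integral_prod _ hFint]
    _ = ∫ ω, ∫ v, F ((S ω, x ω), v) ∂(P.map w) ∂P :=
        integral_map (by fun_prop) hF.stronglyMeasurable.integral_prod_right'.aestronglyMeasurable
    _ ≤ ∫ ω, Real.exp (B ^ 2 * t ^ 2 / 2) * Real.exp (t * S ω) ∂P := by
        refine integral_mono_of_nonneg
          (.of_forall fun ω => integral_nonneg fun v => (Real.exp_pos _).le)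
          ((hc.integrable_exp_mul t).const_mul _) (.of_forall fun ω => ?_)
        have e : ∫ v, (F ∘ Prod.mk (S ω, x ω)) v ∂(P.map w)
            = Real.exp (t * S ω) * mgf (fun ω' => M (x ω) - h (x ω, w ω')) P t := by
          rw [integral_map hw.aemeasurable
            (hF.comp (measurable_prodMk_left (x := (S ω, x ω)))).aestronglyMeasurable,
            mgf, ← integral_const_mul]
          refine integral_congr_ae (.of_forall fun ω' => ?_)
          simp only [F, Function.comp_apply]
          rw [mul_add, Real.exp_add]
        refine e.trans_le ?_
        rw [mul_comm]
        exact mul_le_mul_of_nonneg_right (hgauss _) (Real.exp_pos _).le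
    _ ≤ Real.exp (B ^ 2 * t ^ 2 / 2) * Real.exp (c * t ^ 2 / 2) := by
        rw [integral_const_mul]
        exact mul_le_mul_of_nonneg_left (hc.mgf_le t) (Real.exp_pos _).le
    _ = Real.exp (((c + B ^ 2 : NNReal) : ℝ) * t ^ 2 / 2) := by
        rw [← Real.exp_add]; congr 1; push_cast; ring

/-- An Azuma–Hoeffding inequality: the states `x t` depend on the rounds before `t`, and each round
is independent of its past. -/
lemma measureReal_sum_ge_le {W E : Type*} [MeasurableSpace W] [MeasurableSpace E]
    {w : ℕ → Ω → W} (hw : ∀ t, Measurable (w t))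
    (hind : ∀ t, Indep (past w t) (MeasurableSpace.comap (w t) inferInstance) P)
    {x : ℕ → Ω → E} (hx : ∀ t, Measurable[past w t] (x t)) {h : ℕ → E × W → ℝ}
    (hh : ∀ t, 1 ≤ t → Measurable (h t)) {B : NNReal} (hB : ∀ t, 1 ≤ t → ∀ p, |h t p| ≤ B)
    (T : ℕ) {ε : ℝ}
    (hε : 0 ≤ ε) :
    P.real {ω | ε ≤ ∑ t ∈ Finset.Icc 1 T,
      (∫ ω', h t (x t ω, w t ω') ∂P - h t (x t ω, w t ω))} ≤
        Real.exp (-ε ^ 2 / (2 * (T * (B : ℝ) ^ 2))) := by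
  let S : ℕ → Ω → ℝ := fun n ω => ∑ t ∈ Finset.Icc 1 n,
    (∫ ω', h t (x t ω, w t ω') ∂P - h t (x t ω, w t ω))
  have hSsucc : ∀ n ω, S (n + 1) ω = S n ω + (∫ ω', h (n + 1) (x (n + 1) ω, w (n + 1) ω') ∂P
      - h (n + 1) (x (n + 1) ω, w (n + 1) ω)) := fun n ω => Finset.sum_Icc_succ_top (by omega) _
  have hSm : ∀ n, Measurable[past w (n + 1)] (S n) := by
    intro n
    refine Finset.measurable_sum _ fun t ht => ?_
    obtain ⟨ht1, ht2⟩ := Finset.mem_Icc.1 ht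
    have htn : t < n + 1 := by omega
    have hxt : Measurable[past w (n + 1)] (x t) := (hx t).mono (past_mono w htn.le) le_rfl
    have hM : Measurable fun y => ∫ ω', h t (y, w t ω') ∂P := by
      have h1 : Measurable fun p : E × Ω => h t (p.1, w t p.2) :=
        (hh t ht1).comp (measurable_fst.prodMk ((hw t).comp measurable_snd))
      exact h1.stronglyMeasurable.integral_prod_right'.measurable
    exact (hM.comp hxt).sub ((hh t ht1).comp (hxt.prodMk (measurable_past w htn)))
  have hSC : ∀ n ω, |S n ω| ≤ n * (B + B) := by
    intro n ω
    refine (Finset.abs_sum_le_sum_abs _ _).trans ?_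
    refine (Finset.sum_le_card_nsmul _ _ ((B : ℝ) + B) fun t ht => ?_).trans (by simp [mul_add])
    have hBt := hB t (Finset.mem_Icc.1 ht).1
    refine (abs_sub _ _).trans (add_le_add ?_ (hBt _))
    have := norm_integral_le_of_norm_le_const (μ := P) (f := fun ω' => h t (x t ω, w t ω'))
      (C := B) (.of_forall fun ω' => hBt _)
    simpa using this
  have hsub : ∀ n : ℕ, HasSubgaussianMGF (S n) (n * B ^ 2) P := by
    intro n
    induction n with
    | zero => simp [S]
    | succ n ih =>
      have h1 : IndepFun (fun ω => (S n ω, x (n + 1) ω)) (w (n + 1)) P := by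
        rw [IndepFun_iff_Indep]
        exact indep_of_indep_of_le_left (hind (n + 1)) ((hSm n).prodMk (hx (n + 1))).comap_le
      have h2 := hasSubgaussianMGF_add_of_indep (hw (n + 1))
        ((hSm n).mono (past_le hw _) le_rfl) ((hx (n + 1)).mono (past_le hw _) le_rfl) h1
        (hh (n + 1) (by omega)) (hB (n + 1) (by omega)) (hSC n) ih
      have e : S (n + 1) = fun ω => S n ω + (∫ ω', h (n + 1) (x (n + 1) ω, w (n + 1) ω') ∂P
          - h (n + 1) (x (n + 1) ω, w (n + 1) ω)) := funext (hSsucc n)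
      rw [e]
      convert h2 using 1
      push_cast; ring
  have := (hsub T).measure_ge_le hε
  simpa only [NNReal.coe_mul, NNReal.coe_natCast, NNReal.coe_pow] using this

end Concentration

/-! ### Independence of the rounds of the algorithm -/

section Rounds

variable {d : ℕ} {Ξ Ω : Type*} [MeasurableSpace Ξ] [mΩ : MeasurableSpace Ω] {P : Measure Ω}
  {D : ℕ → Measure Ξ} {u : ℕ → Ω → UnitSphere d} {ξ : ℕ → ℕ → Ω → Ξ}

/-- The random inputs of the algorithm in round `t`: the direction and the noise samples. -/
def roundInput (u : ℕ → Ω → UnitSphere d) (ξ : ℕ → ℕ → Ω → Ξ) (t : ℕ) (ω : Ω) :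
    UnitSphere d × (ℕ → Ξ) :=
  (u t ω, fun i => ξ t i ω)

lemma SampleModel.measurable_roundInput (h : SampleModel P D u ξ) (t : ℕ) :
    Measurable (roundInput u ξ t) :=
  (h.measurable_u t).prodMk (measurable_pi_lambda _ (h.measurable_noise t))

/-- The σ-algebras of the single directions and of the single noise samples. -/
abbrev inputAlgebra (u : ℕ → Ω → UnitSphere d) (ξ : ℕ → ℕ → Ω → Ξ) :
    ℕ ⊕ (ℕ × ℕ) → MeasurableSpace Ω :=
  Sum.elim (fun t => MeasurableSpace.comap (u t) inferInstance)
    fun p => MeasurableSpace.comap (ξ p.1 p.2) inferInstance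

lemma SampleModel.iIndep_inputAlgebra (h : SampleModel P D u ξ) :
    iIndep (inputAlgebra u ξ) P := by
  rw [iIndep_iff]
  intro s f hf
  rw [← Finset.toLeft_disjSum_toRight (u := s)] at hf ⊢
  generalize s.toLeft = A at *
  generalize s.toRight = B at *
  have hA : ∀ i ∈ A, MeasurableSet[MeasurableSpace.comap (u i) inferInstance] (f (.inl i)) :=
    fun i hi => hf (.inl i) (by simpa using hi)
  have hB : ∀ p ∈ B, MeasurableSet[MeasurableSpace.comap (ξ p.1 p.2) inferInstance] (f (.inr p)) :=
    fun p hp => hf (.inr p) (by simpa using hp)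
  have hset : (⋂ i ∈ A.disjSum B, f i) = (⋂ i ∈ A, f (.inl i)) ∩ ⋂ p ∈ B, f (.inr p) := by
    ext ω
    simp only [Set.mem_iInter, Set.mem_inter_iff]
    constructor
    · exact fun hω => ⟨fun i hi => hω _ (by simpa using hi), fun p hp => hω _ (by simpa using hp)⟩
    · rintro ⟨h1, h2⟩ (i | p) hi
      · exact h1 i (by simpa using hi)
      · exact h2 p (by simpa using hi)
  have hA' : MeasurableSet[MeasurableSpace.comap (fun ω t => u t ω) inferInstance]
      (⋂ i ∈ A, f (.inl i)) := by
    refine Finset.measurableSet_biInter _ fun i hi => ?_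
    obtain ⟨g, hg, hgf⟩ := hA i hi
    exact ⟨(fun v => v i) ⁻¹' g, measurable_pi_apply i hg, hgf⟩
  have hB' : MeasurableSet[MeasurableSpace.comap (fun ω (p : ℕ × ℕ) => ξ p.1 p.2 ω) inferInstance]
      (⋂ p ∈ B, f (.inr p)) := by
    refine Finset.measurableSet_biInter _ fun p hp => ?_
    obtain ⟨g, hg, hgf⟩ := hB p hp
    exact ⟨(fun v => v p) ⁻¹' g, measurable_pi_apply p hg, hgf⟩
  rw [hset, (Indep_iff _ _ _).1 h.indep_u_noise _ _ hA' hB', Finset.prod_disjSum,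
    (iIndep_iff _ _).1 h.indep_u A hA, (iIndep_iff _ _).1 h.indep_noise B hB]

lemma SampleModel.indep_past (h : SampleModel P D u ξ) (t : ℕ) :
    Indep (past (roundInput u ξ) t) (MeasurableSpace.comap (roundInput u ξ t) inferInstance) P := by
  -- the indices of the inputs that belong to a round in a given set
  let I : Set ℕ → Set (ℕ ⊕ (ℕ × ℕ)) := fun A => {j | Sum.elim id Prod.fst j ∈ A}
  have hle : ∀ j, inputAlgebra u ξ j ≤ mΩ := by
    rintro (s | p)
    · exact (h.measurable_u s).comap_le
    · exact (h.measurable_noise p.1 p.2).comap_le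
  have hround : ∀ (A : Set ℕ), ∀ s ∈ A, MeasurableSpace.comap (roundInput u ξ s) inferInstance ≤
      ⨆ j ∈ I A, inputAlgebra u ξ j := by
    intro A s hs
    suffices Measurable[⨆ j ∈ I A, inputAlgebra u ξ j] (roundInput u ξ s) from this.comap_le
    have hle : ∀ j ∈ I A, inputAlgebra u ξ j ≤ ⨆ j ∈ I A, inputAlgebra u ξ j := fun j hj =>
      le_iSup₂_of_le (f := fun j (_ : j ∈ I A) => inputAlgebra u ξ j) j hj le_rfl
    have hu : Measurable[⨆ j ∈ I A, inputAlgebra u ξ j] (u s) :=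
      measurable_iff_comap_le.2 (hle (.inl s) hs)
    have hξ : ∀ i, Measurable[⨆ j ∈ I A, inputAlgebra u ξ j] (ξ s i) := fun i =>
      measurable_iff_comap_le.2 (hle (.inr (s, i)) hs)
    exact hu.prodMk (@measurable_pi_lambda _ _ _ (_) _ _ hξ)
  have hdisj : Disjoint (I (Set.Iio t)) (I {t}) := by
    rw [Set.disjoint_left]
    intro j h1 h2
    exact absurd h2 (ne_of_lt h1)
  exact indep_of_indep_of_le_left (indep_of_indep_of_le_right
    (indep_iSup_of_disjoint hle h.iIndep_inputAlgebra hdisj) (hround _ t rfl))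
    (iSup₂_le fun s hs => hround _ s hs)

end Rounds

/-! ### Batches and epochs -/

lemma batch_eq {Δ t : ℕ} (hΔ : 1 ≤ Δ) (ht : 1 ≤ t) : batch Δ t = (t - 1) / Δ + 1 := by
  have hΔ' : (0 : ℚ) < Δ := by exact_mod_cast hΔ
  rw [batch, Nat.ceil_eq_iff (by exact Nat.succ_ne_zero _), Nat.add_sub_cancel,
    lt_div_iff₀ hΔ', div_le_iff₀ hΔ']
  have h1 := Nat.div_add_mod (t - 1) Δ
  have h2 := Nat.mod_lt (t - 1) hΔ
  rw [mul_comm] at h1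
  constructor
  · exact_mod_cast (by omega : (t - 1) / Δ * Δ < t)
  · have : t ≤ ((t - 1) / Δ + 1) * Δ := by rw [add_mul]; omega
    exact_mod_cast this

lemma epoch_eq {Δ t : ℕ} (hΔ : 1 ≤ Δ) (ht : 1 ≤ t) : epoch Δ t = (t - 1) % Δ + 1 := by
  rw [epoch, batch_eq hΔ ht, Nat.add_sub_cancel]
  have h1 := Nat.div_add_mod (t - 1) Δ
  rw [mul_comm] at h1
  omega

lemma epoch_mem {Δ t : ℕ} (hΔ : 1 ≤ Δ) (ht : 1 ≤ t) : epoch Δ t ∈ Finset.Icc 1 Δ := by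
  rw [epoch_eq hΔ ht, Finset.mem_Icc]
  have := Nat.mod_lt (t - 1) hΔ
  omega

/-- A sum over epochs is at most the number of batches, complete or not, times the sum over one
batch. -/
lemma sum_epoch_le {Δ : ℕ} (hΔ : 1 ≤ Δ) {g : ℕ → ℝ} (hg : ∀ τ, 0 ≤ g τ) (T : ℕ) :
    ∑ t ∈ Finset.Icc 1 T, g (epoch Δ t) ≤ ((T / Δ : ℕ) + 1) * ∑ τ ∈ Finset.Icc 1 Δ, g τ := by
  have hshift : ∀ (n : ℕ) (f : ℕ → ℝ),
      ∑ t ∈ Finset.Icc 1 n, f t = ∑ t ∈ Finset.range n, f (t + 1) :=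
    fun n f => by rw [Finset.range_eq_Ico, Finset.sum_Ico_add' f 0 n 1]; rfl
  have hk : ∀ k : ℕ, ∑ t ∈ Finset.range (k * Δ), g (t % Δ + 1)
      = k * ∑ τ ∈ Finset.range Δ, g (τ + 1) := by
    intro k
    induction k with
    | zero => simp
    | succ k ih =>
      rw [add_mul, one_mul, Finset.sum_range_add, ih]
      push_cast
      rw [add_mul, one_mul]
      congr 1
      refine Finset.sum_congr rfl fun τ hτ => ?_
      rw [Nat.mul_add_mod', Nat.mod_eq_of_lt (Finset.mem_range.1 hτ)]
  have hT : T ≤ (T / Δ + 1) * Δ := by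
    have h1 := Nat.div_add_mod T Δ
    have h2 := Nat.mod_lt T hΔ
    rw [mul_comm] at h1
    rw [add_mul]; omega
  rw [hshift, hshift]
  calc ∑ t ∈ Finset.range T, g (epoch Δ (t + 1)) = ∑ t ∈ Finset.range T, g (t % Δ + 1) :=
        Finset.sum_congr rfl fun t _ => by rw [epoch_eq hΔ (by omega), Nat.add_sub_cancel]
    _ ≤ ∑ t ∈ Finset.range ((T / Δ + 1) * Δ), g (t % Δ + 1) :=
        Finset.sum_le_sum_of_subset_of_nonneg (Finset.range_mono hT) fun _ _ _ => hg _
    _ = _ := by rw [hk]; push_cast; rfl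

/-- The first iteration of the batch of iteration `t ≥ 1`. -/
def batchStart (Δ t : ℕ) : ℕ := (t - 1) / Δ * Δ + 1

lemma batchStart_le {Δ t : ℕ} (ht : 1 ≤ t) : batchStart Δ t ≤ t := by
  have := Nat.div_mul_le_self (t - 1) Δ
  unfold batchStart; omega

lemma lt_batchStart_add {Δ t : ℕ} (hΔ : 1 ≤ Δ) (ht : 1 ≤ t) : t < batchStart Δ t + Δ := by
  have h1 := Nat.div_add_mod (t - 1) Δ
  have h2 := Nat.mod_lt (t - 1) hΔ
  rw [mul_comm] at h1
  unfold batchStart; omega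

lemma batchStart_succ {Δ t : ℕ} (ht : 1 ≤ t) (h : ¬Δ ∣ t) :
    batchStart Δ (t + 1) = batchStart Δ t := by
  obtain ⟨s, rfl⟩ : ∃ s, t = s + 1 := ⟨t - 1, by omega⟩
  simp only [batchStart, Nat.add_sub_cancel, Nat.succ_div_of_not_dvd h]

/-- Telescoping of squared distances to a comparator that changes only when a new batch starts. -/
lemma sum_sq_dist_le {E : Type*} [SeminormedAddCommGroup E] {Δ T : ℕ} (hT : 1 ≤ T) {R : ℝ}
    {x y : ℕ → E} (hR : ∀ t ∈ Finset.Icc 1 T, ‖x t - y t‖ ≤ R)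
    (hy : ∀ t, 1 ≤ t → ¬Δ ∣ t → y (t + 1) = y t) :
    ∑ t ∈ Finset.Icc 1 T, (‖x t - y t‖ ^ 2 - ‖x (t + 1) - y t‖ ^ 2) ≤
      R ^ 2 * (1 + (T / Δ : ℕ)) := by
  have hsq : ∀ t ∈ Finset.Icc 1 T, ‖x t - y t‖ ^ 2 ≤ R ^ 2 := fun t ht =>
    pow_le_pow_left₀ (norm_nonneg _) (hR t ht) 2
  have key : ∀ n, n + 1 ≤ T →
      ∑ t ∈ Finset.Icc 1 (n + 1), (‖x t - y t‖ ^ 2 - ‖x (t + 1) - y t‖ ^ 2)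
        + ‖x (n + 2) - y (n + 1)‖ ^ 2 ≤ R ^ 2 * (1 + (n / Δ : ℕ)) := by
    intro n
    induction n with
    | zero =>
      intro h
      have := hsq 1 (by simpa using h)
      simpa using this
    | succ n ih =>
      intro h
      have ih := ih (by omega)
      have hn := hsq (n + 1 + 1) (by simp; omega)
      rw [Finset.sum_Icc_succ_top (by omega)]
      by_cases hd : Δ ∣ n + 1
      · rw [Nat.succ_div_of_dvd hd]
        push_cast
        nlinarith [sq_nonneg ‖x (n + 2) - y (n + 1)‖]
      · rw [Nat.succ_div_of_not_dvd hd, hy (n + 1) (by omega) hd]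
        linarith
  obtain ⟨n, rfl⟩ : ∃ n, T = n + 1 := ⟨T - 1, by omega⟩
  have h1 := key n le_rfl
  have h2 : ((n / Δ : ℕ) : ℝ) ≤ ((n + 1) / Δ : ℕ) := by
    exact_mod_cast Nat.div_le_div_right (by omega)
  nlinarith [sq_nonneg ‖x (n + 2) - y (n + 1)‖, sq_nonneg R]

/-- Keeping the minimizer of the first cost of each batch throughout the batch costs at most the
batch length times twice the variation of the costs. -/
lemma sum_batchStart_sub_le {E : Type*} {X : Set E} {C : ℕ → E → ℝ} {Δ T : ℕ} (hΔ : 1 ≤ Δ)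
    {w : ℕ → ℝ} (hw : ∀ s, 0 ≤ w s)
    (hC : ∀ s ∈ Finset.Icc 2 T, ∀ x ∈ X, |C (s - 1) x - C s x| ≤ w s) {xs : ℕ → E}
    (hxs : ∀ t ∈ Finset.Icc 1 T, xs t ∈ X ∧ IsMinOn (C t) X (xs t)) :
    ∑ t ∈ Finset.Icc 1 T, (C t (xs (batchStart Δ t)) - C t (xs t)) ≤
      2 * Δ * ∑ s ∈ Finset.Icc 2 T, w s := by
  have hdrift : ∀ f, 1 ≤ f → ∀ t, f ≤ t → t ≤ T → ∀ x ∈ X,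
      |C f x - C t x| ≤ ∑ s ∈ Finset.Ioc f t, w s := by
    intro f hf t hft
    induction t, hft using Nat.le_induction with
    | base => simp
    | succ t hft ih =>
      intro htT x hx
      rw [← Finset.insert_Ioc_right_eq_Ioc_add_one hft, Finset.sum_insert (by simp)]
      have h1 := ih (by omega) x hx
      have h2 := hC (t + 1) (by simp; omega) x hx
      rw [Nat.add_sub_cancel] at h2
      linarith [abs_sub_le (C f x) (C t x) (C (t + 1) x)]
  have hterm : ∀ t ∈ Finset.Icc 1 T, C t (xs (batchStart Δ t)) - C t (xs t) ≤
      2 * ∑ s ∈ Finset.Ioc (batchStart Δ t) t, w s := by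
    intro t ht
    have ht' := Finset.mem_Icc.1 ht
    have hb : batchStart Δ t ≤ t := batchStart_le ht'.1
    have hb1 : 1 ≤ batchStart Δ t := by unfold batchStart; omega
    obtain ⟨h1, h2⟩ := hxs (batchStart Δ t) (Finset.mem_Icc.2 ⟨hb1, hb.trans ht'.2⟩)
    obtain ⟨h3, -⟩ := hxs t ht
    have h4 := hdrift _ hb1 t hb ht'.2 _ h1
    have h5 := hdrift _ hb1 t hb ht'.2 _ h3
    have h6 := isMinOn_iff.1 h2 _ h3
    linarith [(abs_le.1 h4).1, (abs_le.1 h5).2]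
  refine (Finset.sum_le_sum hterm).trans ?_
  rw [← Finset.mul_sum, mul_assoc]
  refine mul_le_mul_of_nonneg_left ?_ zero_le_two
  rw [Finset.sum_comm' (t' := Finset.Icc 2 T)
    (s' := fun s => (Finset.Icc 1 T).filter fun t => s ∈ Finset.Ioc (batchStart Δ t) t),
    Finset.mul_sum]
  · refine Finset.sum_le_sum fun s _ => ?_
    rw [Finset.sum_const, nsmul_eq_mul]
    refine mul_le_mul_of_nonneg_right ?_ (hw s)
    have : (Finset.Icc 1 T).filter (fun t => s ∈ Finset.Ioc (batchStart Δ t) t)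
        ⊆ Finset.Ico s (s + Δ) := by
      intro t ht
      simp only [Finset.mem_filter, Finset.mem_Icc, Finset.mem_Ioc, Finset.mem_Ico] at ht ⊢
      have := lt_batchStart_add hΔ ht.1.1
      omega
    exact_mod_cast (Finset.card_le_card this).trans (by simp)
  · intro t s
    simp only [Finset.mem_filter, Finset.mem_Icc, Finset.mem_Ioc]
    constructor
    · rintro ⟨⟨h1, h2⟩, h3, h4⟩
      have : 1 ≤ batchStart Δ t := by unfold batchStart; omega
      exact ⟨⟨⟨h1, h2⟩, h3, h4⟩, by omega, by omega⟩
    · rintro ⟨⟨h1, h3⟩, -⟩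
      exact ⟨h1, h3⟩

/-! ### The gradient estimates of the algorithm -/

/-- The standing assumptions on the inputs of the algorithm, for a cost bounded by `U` and
Lipschitz with constant `L₀`. -/
structure AlgInput.IsRegular {d : ℕ} {Ξ : Type*} [PseudoMetricSpace Ξ] (A : AlgInput d Ξ)
    (U L₀ : ℝ) : Prop where
  convex : Convex ℝ A.X
  compact : IsCompact A.X
  ball_subset : Metric.closedBall 0 A.r ⊆ A.X
  cost : IsRegularCost A.X A.J U L₀
  U_pos : 0 < U
  L_pos : 0 < L₀
  α_pos : 0 < A.α
  α_le : A.α ≤ 1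
  δ_pos : 0 < A.δ
  δ_lt : A.δ < A.r
  Δ_pos : 1 ≤ A.Δ
  φ_pos : ∀ τ ∈ Finset.Icc 1 A.Δ, 1 ≤ A.φ τ
  init_mem : A.init ∈ shrunkSet A.X A.r A.δ

namespace AlgInput

variable {d : ℕ} {Ξ : Type*} {A : AlgInput d Ξ} {U L₀ : ℝ}

/-- The shrunk feasible set, which contains all iterates. -/
abbrev iterateSet (A : AlgInput d Ξ) : Set (Vec d) := shrunkSet A.X A.r A.δ

lemma iterate_succ (A : AlgInput d Ξ) (u : ℕ → UnitSphere d) (z : ℕ → ℕ → Ξ) {t : ℕ} (ht : 1 ≤ t) :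
    A.iterate u z (t + 1) = proj A.iterateSet (A.iterate u z t - A.σ (epoch A.Δ t) •
      A.gradEst t (A.iterate u z t) (u t) (z t)) := by
  obtain ⟨s, rfl⟩ : ∃ s, t = s + 1 := ⟨t - 1, by omega⟩
  rfl

section

variable [PseudoMetricSpace Ξ]

lemma IsRegular.convex_iterateSet (hA : A.IsRegular U L₀) : Convex ℝ A.iterateSet :=
  convex_shrunkSet hA.convex

lemma IsRegular.isClosed_iterateSet (hA : A.IsRegular U L₀) : IsClosed A.iterateSet :=
  isClosed_shrunkSet hA.compact.isClosed

lemma IsRegular.proj_mem (hA : A.IsRegular U L₀) (x : Vec d) : proj A.iterateSet x ∈ A.iterateSet :=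
  (proj_spec ⟨_, hA.init_mem⟩ hA.convex_iterateSet hA.isClosed_iterateSet x).1

lemma IsRegular.iterate_mem (hA : A.IsRegular U L₀) (u : ℕ → UnitSphere d) (z : ℕ → ℕ → Ξ) :
    ∀ t, A.iterate u z t ∈ A.iterateSet
  | 0 => hA.init_mem
  | 1 => hA.init_mem
  | _ + 2 => hA.proj_mem _

lemma IsRegular.add_smul_mem (hA : A.IsRegular U L₀) {x : Vec d} (hx : x ∈ A.iterateSet)
    (u : UnitSphere d) : x + A.δ • (u : Vec d) ∈ A.X :=
  add_smul_mem_of_mem_shrunkSet hA.convex hA.ball_subset hA.δ_pos hA.δ_lt hx u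

lemma IsRegular.one_le_φ (hA : A.IsRegular U L₀) {t : ℕ} (ht : 1 ≤ t) :
    1 ≤ A.φ (epoch A.Δ t) :=
  hA.φ_pos _ (epoch_mem hA.Δ_pos ht)

lemma IsRegular.norm_gradEst_le (hA : A.IsRegular U L₀) {t : ℕ} (ht : 1 ≤ t) {x : Vec d}
    (hx : x ∈ A.iterateSet) (u : UnitSphere d) (z : ℕ → Ξ) : ‖A.gradEst t x u z‖ ≤ d / A.δ * U := by
  have hδ := hA.δ_pos
  rw [gradEst, norm_smul, norm_eq_of_mem_sphere u, mul_one, Real.norm_eq_abs, abs_mul,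
    abs_of_nonneg (by positivity : 0 ≤ (d : ℝ) / A.δ)]
  exact mul_le_mul_of_nonneg_left (abs_cvar_empiricalLaw_le hA.α_pos hA.α_le (hA.one_le_φ ht)
    fun i => hA.cost.bound _ (hA.add_smul_mem hx u) _) (by positivity)

lemma IsRegular.norm_sub_le (hA : A.IsRegular U L₀) {x y : Vec d} (hx : x ∈ A.X) (hy : y ∈ A.X) :
    ‖x - y‖ ≤ Metric.diam A.X := by
  rw [← dist_eq_norm]
  exact Metric.dist_le_diam_of_mem hA.compact.isBounded hx hy

/-- The pathwise regret bound of projected gradient descent with constant step size `η`, against a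
comparator that changes only when a new batch starts. -/
lemma IsRegular.sum_inner_le (hA : A.IsRegular U L₀) {η : ℝ} (hη : 0 < η)
    (hσ : ∀ τ, A.σ τ = η) {T : ℕ} (hT : 1 ≤ T) {y : ℕ → Vec d}
    (hyS : ∀ t ∈ Finset.Icc 1 T, y t ∈ A.iterateSet) (hy : ∀ t, 1 ≤ t → ¬A.Δ ∣ t → y (t + 1) = y t)
    (u : ℕ → UnitSphere d) (z : ℕ → ℕ → Ξ) :
    ∑ t ∈ Finset.Icc 1 T, inner ℝ (A.gradEst t (A.iterate u z t) (u t) (z t))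
      (A.iterate u z t - y t) ≤
      Metric.diam A.X ^ 2 * (1 + (T / A.Δ : ℕ)) / (2 * η) + T * (η / 2 * (d / A.δ * U) ^ 2) := by
  set x := A.iterate u z with hx
  have hδ := hA.δ_pos
  have hU := hA.U_pos
  have hstep : ∀ t ∈ Finset.Icc 1 T,
      inner ℝ (A.gradEst t (x t) (u t) (z t)) (x t - y t) ≤
        (‖x t - y t‖ ^ 2 - ‖x (t + 1) - y t‖ ^ 2) / (2 * η) + η / 2 * (d / A.δ * U) ^ 2 := by
    intro t ht
    have ht1 := (Finset.mem_Icc.1 ht).1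
    have h := inner_le_of_proj_step hA.convex_iterateSet hA.isClosed_iterateSet hη (hyS t ht) (x t)
      (A.gradEst t (x t) (u t) (z t))
    have e : x (t + 1) = proj A.iterateSet (x t - η • A.gradEst t (x t) (u t) (z t)) := by
      rw [hx, A.iterate_succ u z ht1, hσ]
    rw [← e] at h
    refine h.trans (add_le_add_right ?_ _)
    gcongr
    exact hA.norm_gradEst_le ht1 (hA.iterate_mem u z t) _ _
  refine (Finset.sum_le_sum hstep).trans ?_
  rw [Finset.sum_add_distrib, ← Finset.sum_div]
  refine add_le_add ?_ (le_of_eq (by simp))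
  gcongr
  exact sum_sq_dist_le hT (fun t ht => hA.norm_sub_le (hA.iterate_mem u z t).1 (hyS t ht).1) hy

variable [MeasurableSpace Ξ] [BorelSpace Ξ]

/-- The cost is jointly measurable in action and noise, being continuous in the action and
measurable in the noise. Actions outside the feasible set, where nothing is assumed on the cost,
are projected. -/
lemma IsRegular.measurable_cost (hA : A.IsRegular U L₀) :
    Measurable fun p : Vec d × Ξ => A.J (proj A.X p.1) p.2 := by
  have hne : A.X.Nonempty := ⟨_, hA.init_mem.1⟩
  have hproj := proj_spec hne hA.convex hA.compact.isClosed
  refine measurable_uncurry_of_continuous_of_measurable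
    (u := fun (x : Vec d) z => A.J (proj A.X x) z) (fun z => ?_)
    fun x => hA.cost.measurable hA.L_pos.le (hproj x).1
  have hc : ContinuousOn (fun x => A.J x z) A.X :=
    (LipschitzOnWith.of_dist_le_mul (K := ⟨L₀, hA.L_pos.le⟩) fun a ha b hb => by
      rw [Real.dist_eq, dist_eq_norm]
      exact hA.cost.lipschitz_action z a ha b hb).continuousOn
  exact hc.comp_continuous (continuous_proj hne hA.convex hA.compact.isClosed) fun x => (hproj x).1

lemma IsRegular.measurable_cvar (hA : A.IsRegular U L₀) {n : ℕ} (hn : 1 ≤ n) :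
    Measurable fun p : Vec d × (UnitSphere d × (ℕ → Ξ)) => cvar A.α (empiricalLaw n fun i =>
      A.J (proj A.iterateSet p.1 + A.δ • (p.2.1 : Vec d)) (p.2.2 i)) := by
  have hne : A.iterateSet.Nonempty := ⟨_, hA.init_mem⟩
  have hp : Measurable (proj A.iterateSet) :=
    (continuous_proj hne hA.convex_iterateSet hA.isClosed_iterateSet).measurable
  have e : ∀ (x : Vec d) (u : UnitSphere d), proj A.X (proj A.iterateSet x + A.δ • (u : Vec d))
      = proj A.iterateSet x + A.δ • (u : Vec d) := fun x u =>
    proj_eq_self hA.convex hA.compact.isClosed (hA.add_smul_mem (hA.proj_mem x) u)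
  refine (continuous_cvar_empiricalLaw hA.α_pos hA.α_le hn).measurable.comp
    (measurable_pi_lambda _ fun i => ?_)
  have h := hA.measurable_cost.comp (f := fun p : Vec d × (UnitSphere d × (ℕ → Ξ)) =>
    (proj A.iterateSet p.1 + A.δ • (p.2.1 : Vec d), p.2.2 i)) (by fun_prop)
  simpa only [Function.comp_def, e] using h

lemma IsRegular.measurable_gradEst (hA : A.IsRegular U L₀) {t : ℕ} (ht : 1 ≤ t) :
    Measurable fun p : Vec d × (UnitSphere d × (ℕ → Ξ)) =>
      A.gradEst t (proj A.iterateSet p.1) p.2.1 p.2.2 := by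
  have h := hA.measurable_cvar (hA.one_le_φ ht)
  unfold gradEst
  fun_prop

lemma IsRegular.measurable_iterate {Ω : Type*} (hA : A.IsRegular U L₀) (u : ℕ → Ω → UnitSphere d)
    (ξ : ℕ → ℕ → Ω → Ξ) : ∀ t, Measurable[past (roundInput u ξ) t]
      fun ω => A.iterate (fun t => u t ω) (fun t i => ξ t i ω) t
  | 0 => measurable_const
  | 1 => measurable_const
  | t + 2 => by
    have hne : A.iterateSet.Nonempty := ⟨_, hA.init_mem⟩
    have hp : Measurable (proj A.iterateSet) :=
      (continuous_proj hne hA.convex_iterateSet hA.isClosed_iterateSet).measurable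
    have ih : Measurable[past (roundInput u ξ) (t + 2)] fun ω =>
        A.iterate (fun t => u t ω) (fun t i => ξ t i ω) (t + 1) :=
      (hA.measurable_iterate u ξ (t + 1)).mono (past_mono _ (by omega)) le_rfl
    have hg : Measurable fun p : Vec d × (UnitSphere d × (ℕ → Ξ)) =>
        proj A.iterateSet (p.1 - A.σ (epoch A.Δ (t + 1)) •
          A.gradEst (t + 1) (proj A.iterateSet p.1) p.2.1 p.2.2) := by
      have := hA.measurable_gradEst (Nat.le_add_left 1 t)
      exact hp.comp (by fun_prop)
    have h := hg.comp (ih.prodMk (measurable_past (roundInput u ξ) (Nat.lt_succ_self (t + 1))))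
    simp only [Function.comp_def, roundInput,
      proj_eq_self hA.convex_iterateSet hA.isClosed_iterateSet (hA.iterate_mem _ _ (t + 1))] at h
    exact h

variable {Ω : Type*} [MeasurableSpace Ω] {P : Measure Ω} [IsProbabilityMeasure P]
  {D : ℕ → Measure Ξ} {u : ℕ → Ω → UnitSphere d} {ξ : ℕ → ℕ → Ω → Ξ}

/-- The sampling error of the conditional value-at-risk at the random point that is played. The
direction is independent of the noise, so it can be frozen. -/
lemma IsRegular.integral_abs_cvar_sub_le (hA : A.IsRegular U L₀) (hd : 1 ≤ d)
    (hM : SampleModel P D u ξ) {n : ℕ} (hn : 1 ≤ n) {x : Vec d} (hx : x ∈ A.iterateSet) (t : ℕ) :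
    Integrable (fun ω => |cvar A.α (empiricalLaw n fun i =>
        A.J (x + A.δ • (u t ω : Vec d)) (ξ t i ω)) -
        riskCost A.J A.α (D t) (x + A.δ • (u t ω : Vec d))|) P ∧
    ∫ ω, |cvar A.α (empiricalLaw n fun i => A.J (x + A.δ • (u t ω : Vec d)) (ξ t i ω)) -
      riskCost A.J A.α (D t) (x + A.δ • (u t ω : Vec d))| ∂P ≤ 2 * U / A.α / √(n : ℝ) := by
  have hD : IsProbabilityMeasure (D t) := by
    rw [← hM.law_noise t 0]
    exact Measure.isProbabilityMeasure_map (hM.measurable_noise t 0).aemeasurable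
  have hL := hA.L_pos.le
  have hXu := fun v => hA.add_smul_mem hx v
  let G : UnitSphere d × (ℕ → Ξ) → ℝ := fun p =>
    |cvar A.α (empiricalLaw n fun i => A.J (x + A.δ • (p.1 : Vec d)) (p.2 i)) -
      riskCost A.J A.α (D t) (x + A.δ • (p.1 : Vec d))|
  have hcont : Continuous fun v : UnitSphere d =>
      riskCost A.J A.α (D t) (x + A.δ • (v : Vec d)) := by
    have : ContinuousOn (riskCost A.J A.α (D t)) A.X :=
      (LipschitzOnWith.of_dist_le_mul (K := ⟨L₀ / A.α, div_nonneg hL hA.α_pos.le⟩)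
        fun a ha b hb => by
          rw [Real.dist_eq, dist_eq_norm]
          exact riskCost_lipschitz hA.cost hL hA.α_pos hA.α_le ha hb).continuousOn
    exact this.comp_continuous (by fun_prop) hXu
  have hG : Measurable G := by
    have h1 := (hA.measurable_cvar hn).comp (measurable_prodMk_left (x := x))
    simp only [Function.comp_def, proj_eq_self hA.convex_iterateSet hA.isClosed_iterateSet hx] at h1
    exact (h1.sub (hcont.measurable.comp measurable_fst)).abs
  have hGb : ∀ p, |G p| ≤ U + U := by
    intro p
    have := isProbabilityMeasure_map_cost (D := D t) hA.cost hL (hXu p.1)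
    rw [abs_abs]
    exact (abs_sub _ _).trans (add_le_add
      (abs_cvar_empiricalLaw_le hA.α_pos hA.α_le hn fun i => hA.cost.bound _ (hXu p.1) _)
      (abs_cvar_le hA.α_pos hA.α_le (ae_map_cost hA.cost hL (hXu p.1))))
  have hξm : Measurable fun ω i => ξ t i ω := measurable_pi_lambda _ (hM.measurable_noise t)
  have hind : IndepFun (u t) (fun ω i => ξ t i ω) P :=
    hM.indep_u_noise.comp (φ := fun v : ℕ → UnitSphere d => v t)
      (ψ := fun (z : ℕ × ℕ → Ξ) i => z (t, i)) (by fun_prop) (by fun_prop)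
  have hmap := (indepFun_iff_map_prod_eq_prod_map_map (hM.measurable_u t).aemeasurable
    hξm.aemeasurable).1 hind
  have hpm : Measurable fun ω => (u t ω, fun i => ξ t i ω) := (hM.measurable_u t).prodMk hξm
  have hp1 := isProbabilityMeasure_sphereUniform hd
  have hp2 := Measure.isProbabilityMeasure_map (μ := P) hξm.aemeasurable
  have hGi : Integrable (fun ω => G (u t ω, fun i => ξ t i ω)) P :=
    Integrable.of_bound (hG.comp hpm).aestronglyMeasurable (U + U) (.of_forall fun ω => hGb _)
  refine ⟨hGi, ?_⟩
  calc ∫ ω, G (u t ω, fun i => ξ t i ω) ∂P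
      = ∫ p, G p ∂((sphereUniform d).prod (P.map fun ω i => ξ t i ω)) := by
        rw [← hM.law_u t, ← hmap, integral_map hpm.aemeasurable hG.aestronglyMeasurable]
    _ = ∫ v, ∫ z, G (v, z) ∂(P.map fun ω i => ξ t i ω) ∂(sphereUniform d) :=
        integral_prod _ (Integrable.of_bound hG.aestronglyMeasurable (U + U) (.of_forall hGb))
    _ ≤ ∫ _, 2 * U / A.α / √(n : ℝ) ∂(sphereUniform d) := by
        refine integral_mono_of_nonneg
          (.of_forall fun v => integral_nonneg fun z => abs_nonneg _) (integrable_const _)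
          (.of_forall fun v => ?_)
        have hJm := hA.cost.measurable hL (hXu v)
        have e : ∫ z, G (v, z) ∂(P.map fun ω i => ξ t i ω) = ∫ ω, G (v, fun i => ξ t i ω) ∂P :=
          integral_map hξm.aemeasurable
            (hG.comp (measurable_prodMk_left (x := v))).aestronglyMeasurable
        have h := integral_abs_cvar_empiricalLaw_sub_le (P := P)
          (Y := fun i ω => A.J (x + A.δ • (v : Vec d)) (ξ t i ω))
          (ν := (D t).map (A.J (x + A.δ • (v : Vec d)))) hA.U_pos.le hA.α_pos hA.α_le hn
          (fun i => hJm.comp (hM.measurable_noise t i)) (fun i ω => hA.cost.bound _ (hXu v) _)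
          (fun i j hij => (hM.indep_noise.indepFun (i := (t, i)) (j := (t, j))
            (by simpa using hij)).comp hJm hJm)
          (fun i => by rw [← hM.law_noise t i, Measure.map_map hJm (hM.measurable_noise t i)]; rfl)
        exact e.trans_le h
    _ = 2 * U / A.α / √(n : ℝ) := by simp

/-- In mean, the gradient estimate acts like a subgradient of the risk-averse cost, up to a bias of
order `δ` from the smoothing and of order `1 / (δ √n)` from the `n` samples. -/
lemma IsRegular.sub_le_integral_inner (hA : A.IsRegular U L₀) (hd : 1 ≤ d)
    (hM : SampleModel P D u ξ) {t : ℕ} (ht : 1 ≤ t) {x y : Vec d} (hx : x ∈ A.iterateSet)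
    (hy : y ∈ A.iterateSet) :
    riskCost A.J A.α (D t) x - riskCost A.J A.α (D t) y - 2 * (L₀ / A.α) * A.δ
      - d / A.δ * Metric.diam A.X * (2 * U / A.α) * (1 / √(A.φ (epoch A.Δ t) : ℝ)) ≤
      ∫ ω, inner ℝ (A.gradEst t x (u t ω) fun i => ξ t i ω) (x - y) ∂P := by
  have hD : IsProbabilityMeasure (D t) := by
    rw [← hM.law_noise t 0]
    exact Measure.isProbabilityMeasure_map (hM.measurable_noise t 0).aemeasurable
  have hL := hA.L_pos.le
  have hα := hA.α_pos
  have hδ := hA.δ_pos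
  set n := A.φ (epoch A.Δ t) with hn
  set C := riskCost A.J A.α (D t) with hC
  set R := Metric.diam A.X with hR
  have hR0 : 0 ≤ R := Metric.diam_nonneg
  have hn1 : 1 ≤ n := hA.one_le_φ ht
  have hCconv : ConvexOn ℝ A.X C := convexOn_riskCost hA.convex hA.cost hL hα hA.α_le
  have hClip : ∀ x ∈ A.X, ∀ y ∈ A.X, |C x - C y| ≤ L₀ / A.α * ‖x - y‖ :=
    fun x hx y hy => riskCost_lipschitz hA.cost hL hα hA.α_le hx hy
  have hsmooth := sub_le_integral_gradEst hd (by positivity : 0 ≤ L₀ / A.α) hδ hCconv hClip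
    (hA.add_smul_mem hx) (hA.add_smul_mem hy) hx.1 hy.1
  have hcont : Continuous fun v : UnitSphere d => C (x + A.δ • (v : Vec d)) := by
    have : ContinuousOn C A.X :=
      (LipschitzOnWith.of_dist_le_mul (K := ⟨L₀ / A.α, by positivity⟩) fun a ha b hb => by
          rw [Real.dist_eq, dist_eq_norm]
          exact hClip a ha b hb).continuousOn
    exact this.comp_continuous (by fun_prop) (hA.add_smul_mem hx)
  have hfc : Continuous fun v : UnitSphere d =>
      C (x + A.δ • (v : Vec d)) * inner ℝ (v : Vec d) (x - y) := hcont.mul (by fun_prop)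
  obtain ⟨hei, he⟩ := hA.integral_abs_cvar_sub_le hd hM hn1 hx t
  rw [← hM.law_u t, integral_map (hM.measurable_u t).aemeasurable hfc.aestronglyMeasurable]
    at hsmooth
  have hfi : Integrable (fun ω => C (x + A.δ • (u t ω : Vec d)) *
      inner ℝ (u t ω : Vec d) (x - y)) P := by
    have := integrable_sphereUniform hd hfc
    rw [← hM.law_u t] at this
    exact (integrable_map_measure hfc.aestronglyMeasurable (hM.measurable_u t).aemeasurable).1 this
  have hgi : Integrable (fun ω =>
      inner ℝ (A.gradEst t x (u t ω) fun i => ξ t i ω) (x - y)) P := by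
    have h1 := (hA.measurable_gradEst ht).comp ((measurable_prodMk_left (x := x)).comp
      (hM.measurable_roundInput t))
    simp only [Function.comp_def, roundInput,
      proj_eq_self hA.convex_iterateSet hA.isClosed_iterateSet hx] at h1
    refine Integrable.of_bound (C := d / A.δ * U * ‖x - y‖) ?_ (.of_forall fun ω => ?_)
    · exact (h1.inner measurable_const).aestronglyMeasurable
    · exact (norm_inner_le_norm _ _).trans (mul_le_mul_of_nonneg_right
        (hA.norm_gradEst_le ht hx _ _) (norm_nonneg _))
  have hpt : ∀ ω, d / A.δ * (C (x + A.δ • (u t ω : Vec d)) *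
      inner ℝ (u t ω : Vec d) (x - y)) - d / A.δ * R *
      |cvar A.α (empiricalLaw n fun i => A.J (x + A.δ • (u t ω : Vec d)) (ξ t i ω)) -
        C (x + A.δ • (u t ω : Vec d))| ≤
      inner ℝ (A.gradEst t x (u t ω) fun i => ξ t i ω) (x - y) := by
    intro ω
    rw [gradEst, real_inner_smul_left]
    set s := inner ℝ (u t ω : Vec d) (x - y)
    set q := cvar A.α (empiricalLaw n fun i => A.J (x + A.δ • (u t ω : Vec d)) (ξ t i ω))
    set p := C (x + A.δ • (u t ω : Vec d))
    have hs : |s| ≤ R := by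
      refine (abs_real_inner_le_norm _ _).trans ?_
      rw [norm_eq_of_mem_sphere, one_mul]
      exact hA.norm_sub_le hx.1 hy.1
    have h1 : -(R * |q - p|) ≤ (q - p) * s := by
      have h2 : |(q - p) * s| ≤ R * |q - p| := by
        rw [abs_mul, mul_comm]; exact mul_le_mul_of_nonneg_right hs (abs_nonneg _)
      exact (neg_le_neg h2).trans (neg_abs_le _)
    have h3 : 0 ≤ (d : ℝ) / A.δ := by positivity
    have h4 := mul_le_mul_of_nonneg_left h1 h3
    linarith
  have hle := integral_mono ((hfi.const_mul _).sub (hei.const_mul _)) hgi hpt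
  simp only [Pi.sub_apply] at hle
  rw [integral_sub (hfi.const_mul _) (hei.const_mul _), integral_const_mul,
    integral_const_mul] at hle
  have h5 : d / A.δ * R * ∫ ω, |cvar A.α (empiricalLaw n fun i =>
      A.J (x + A.δ • (u t ω : Vec d)) (ξ t i ω)) - C (x + A.δ • (u t ω : Vec d))| ∂P ≤
      d / A.δ * R * (2 * U / A.α) * (1 / √(n : ℝ)) := by
    rw [mul_assoc (d / A.δ * R), mul_one_div]
    exact mul_le_mul_of_nonneg_left he (by positivity)
  linarith

end

end AlgInput

/-! ### The regret bound -/

namespace AlgInput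

variable {d : ℕ} {Ξ : Type*} [PseudoMetricSpace Ξ] [MeasurableSpace Ξ] [BorelSpace Ξ]
  {A : AlgInput d Ξ} {U L₀ : ℝ} {Ω : Type*} [mΩ : MeasurableSpace Ω] {P : Measure Ω}
  [IsProbabilityMeasure P] {D : ℕ → Measure Ξ} {u : ℕ → Ω → UnitSphere d} {ξ : ℕ → ℕ → Ω → Ξ}

/-- The regret bound before the parameters are chosen. Its terms come from concentration, smoothing
and shrinking, sampling, gradient descent (two terms), and the variation of the costs within a
batch. The comparator of a batch is the shrunk minimizer of its first cost. -/
lemma IsRegular.regret_bound (hA : A.IsRegular U L₀) (hd : 1 ≤ d) (hM : SampleModel P D u ξ)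
    {η : ℝ} (hη : 0 < η) (hσ : ∀ τ, A.σ τ = η) {T : ℕ} (hT : 1 ≤ T) (hΔT : A.Δ ≤ T) {V : ℝ}
    (hV : 0 ≤ V) (hW : ∑ t ∈ Finset.Icc 2 T, wasserstein (D (t - 1)) (D t) ≤ ENNReal.ofReal V)
    {xs : ℕ → Vec d} (hxX : ∀ t, xs t ∈ A.X)
    (hxs : ∀ t ∈ Finset.Icc 1 T, IsMinOn (riskCost A.J A.α (D t)) A.X (xs t)) {S : ℝ}
    (hS : ∑ τ ∈ Finset.Icc 1 A.Δ, 1 / √(A.φ τ : ℝ) ≤ S) {γ : ℝ} (hγ : 0 < γ) (hγ1 : γ < 1) :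
    1 - γ ≤ P.real {ω | dynamicRegret (fun t => riskCost A.J A.α (D t))
      (A.action (fun t => u t ω) fun t i => ξ t i ω) xs T ≤
        d / A.δ * U * Metric.diam A.X * √(2 * T * Real.log (1 / γ))
        + T * (L₀ / A.α) * A.δ * (3 + Metric.diam A.X / A.r)
        + 2 * (T / A.Δ) * (d / A.δ * Metric.diam A.X * (2 * U / A.α)) * S
        + Metric.diam A.X ^ 2 * (T / A.Δ) / η + T * (η / 2 * (d / A.δ * U) ^ 2)
        + 2 * A.Δ * (L₀ / A.α) * V} := by
  have hL := hA.L_pos.le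
  have hα := hA.α_pos
  have hδ := hA.δ_pos
  have hr : 0 < A.r := hδ.trans hA.δ_lt
  have hU := hA.U_pos
  have hd0 : (0 : ℝ) < d := by exact_mod_cast hd
  have hT0 : (0 : ℝ) < T := by exact_mod_cast hT
  have hΔ0 : (0 : ℝ) < A.Δ := by exact_mod_cast hA.Δ_pos
  have hD : ∀ t, IsProbabilityMeasure (D t) := fun t => by
    rw [← hM.law_noise t 0]
    exact Measure.isProbabilityMeasure_map (hM.measurable_noise t 0).aemeasurable
  have h0X : (0 : Vec d) ∈ A.X := hA.ball_subset (Metric.mem_closedBall_self hr.le)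
  set R := Metric.diam A.X with hRdef
  have hR : 0 < R := by
    let v : Vec d := EuclideanSpace.single ⟨0, hd⟩ A.r
    have hv : ‖v‖ = A.r := by simp [v, hr.le]
    have hvX : v ∈ A.X := hA.ball_subset (by simp [hv])
    have := hA.norm_sub_le hvX h0X
    rw [sub_zero, hv] at this
    linarith
  set C : ℕ → Vec d → ℝ := fun t => riskCost A.J A.α (D t) with hC
  set L := L₀ / A.α with hLdef
  have hL0 : 0 ≤ L := by positivity
  have hClip : ∀ t, ∀ x ∈ A.X, ∀ y ∈ A.X, C t x - C t y ≤ L * ‖x - y‖ := fun t x hx y hy =>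
    (le_abs_self _).trans (riskCost_lipschitz hA.cost hL hα hA.α_le hx hy)
  let p : ℕ → Vec d := fun t => xs (batchStart A.Δ t)
  let y : ℕ → Vec d := fun t => (1 - A.δ / A.r) • p t
  have hyS : ∀ t, y t ∈ A.iterateSet := fun t =>
    smul_mem_shrunkSet hA.convex h0X hδ hA.δ_lt (hxX _)
  have hy : ∀ t, 1 ≤ t → ¬A.Δ ∣ t → y (t + 1) = y t := fun t ht h => by
    simp only [y, p, batchStart_succ ht h]
  let h : ℕ → Vec d × (UnitSphere d × (ℕ → Ξ)) → ℝ := fun t q =>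
    inner ℝ (A.gradEst t (proj A.iterateSet q.1) q.2.1 q.2.2) (proj A.iterateSet q.1 - y t)
  have hp : Measurable (proj A.iterateSet) :=
    (continuous_proj ⟨_, hA.init_mem⟩ hA.convex_iterateSet hA.isClosed_iterateSet).measurable
  have hh : ∀ t, 1 ≤ t → Measurable (h t) := fun t ht =>
    (hA.measurable_gradEst ht).inner ((hp.comp measurable_fst).sub_const _)
  let B : NNReal := ⟨d / A.δ * U * R, by positivity⟩
  have hB0 : (0 : ℝ) < B := show 0 < d / A.δ * U * R by positivity
  have hB : ∀ t, 1 ≤ t → ∀ q, |h t q| ≤ B := fun t ht q =>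
    (abs_real_inner_le_norm _ _).trans (mul_le_mul (hA.norm_gradEst_le ht (hA.proj_mem _) _ _)
      (hA.norm_sub_le (hA.proj_mem _).1 (hyS t).1) (norm_nonneg _) (by positivity))
  let x : ℕ → Ω → Vec d := fun t ω => A.iterate (fun t => u t ω) (fun t i => ξ t i ω) t
  have hlog : 0 ≤ Real.log (1 / γ) := Real.log_nonneg (by rw [le_div_iff₀ hγ]; linarith)
  set ε := (B : ℝ) * √(2 * T * Real.log (1 / γ)) with hε
  have hconc := measureReal_sum_ge_le (P := P) hM.measurable_roundInput hM.indep_past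
    (hA.measurable_iterate u ξ) hh hB T (by positivity : 0 ≤ ε)
  have hexp : Real.exp (-ε ^ 2 / (2 * (T * (B : ℝ) ^ 2))) = γ := by
    have : -ε ^ 2 / (2 * (T * (B : ℝ) ^ 2)) = -Real.log (1 / γ) := by
      rw [hε, mul_pow, Real.sq_sqrt (by positivity)]
      field_simp
    rw [this, one_div, Real.log_inv, neg_neg, Real.exp_log hγ]
  rw [hexp] at hconc
  set bad := {ω | ε ≤ ∑ t ∈ Finset.Icc 1 T,
    (∫ ω', h t (x t ω, roundInput u ξ t ω') ∂P - h t (x t ω, roundInput u ξ t ω))} with hbad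
  set bound := d / A.δ * U * R * √(2 * T * Real.log (1 / γ)) + T * L * A.δ * (3 + R / A.r)
        + 2 * (T / A.Δ) * (d / A.δ * R * (2 * U / A.α)) * S
        + R ^ 2 * (T / A.Δ) / η + T * (η / 2 * (d / A.δ * U) ^ 2) + 2 * A.Δ * L * V with hbound
  set good := {ω | dynamicRegret C (A.action (fun t => u t ω) fun t i => ξ t i ω) xs T ≤ bound}
  suffices hcover : ∀ ω, ω ∉ bad → ω ∈ good by
    have h1 : (Set.univ : Set Ω) ⊆ good ∪ bad := fun ω _ => by
      by_cases hω : ω ∈ bad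
      · exact Or.inr hω
      · exact Or.inl (hcover ω hω)
    have h2 := (measureReal_mono (μ := P) h1).trans (measureReal_union_le good bad)
    rw [probReal_univ] at h2
    linarith
  intro ω hω
  rw [hbad, Set.mem_ofPred_eq, not_le, Finset.sum_sub_distrib] at hω
  have hxS : ∀ t, x t ω ∈ A.iterateSet := fun t => hA.iterate_mem _ _ t
  have hproj : ∀ t, proj A.iterateSet (x t ω) = x t ω := fun t =>
    proj_eq_self hA.convex_iterateSet hA.isClosed_iterateSet (hxS t)
  -- pathwise gradient descent; as `Δ ≤ T`, the number of comparators is at most `2 T / Δ`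
  have hogd : ∑ t ∈ Finset.Icc 1 T, h t (x t ω, roundInput u ξ t ω) ≤
      R ^ 2 * (T / A.Δ) / η + T * (η / 2 * (d / A.δ * U) ^ 2) := by
    have h1 := hA.sum_inner_le hη hσ hT (fun t _ => hyS t) hy (fun t => u t ω) fun t i => ξ t i ω
    simp only [h, hproj, roundInput]
    refine h1.trans (add_le_add_left ?_ _)
    have h2 : ((T / A.Δ : ℕ) : ℝ) ≤ T / A.Δ := Nat.cast_div_le
    have h3 : (1 : ℝ) ≤ T / A.Δ := by
      rw [one_le_div hΔ0]; exact_mod_cast hΔT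
    rw [div_le_div_iff₀ (by positivity) hη]
    have h4 : R ^ 2 * (1 + ((T / A.Δ : ℕ) : ℝ)) ≤ R ^ 2 * (2 * (T / A.Δ)) :=
      mul_le_mul_of_nonneg_left (by linarith) (by positivity)
    nlinarith
  -- convexity: regret is at most the mean linearized regret, up to the bias of the estimates
  have hbias : ∑ t ∈ Finset.Icc 1 T, (C t (x t ω) - C t (y t)) ≤
      ∑ t ∈ Finset.Icc 1 T, ∫ ω', h t (x t ω, roundInput u ξ t ω') ∂P + T * (2 * L * A.δ)
        + 2 * (T / A.Δ) * (d / A.δ * R * (2 * U / A.α)) * S := by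
    have h1 : ∀ t ∈ Finset.Icc 1 T, C t (x t ω) - C t (y t) ≤
        ∫ ω', h t (x t ω, roundInput u ξ t ω') ∂P + 2 * L * A.δ
          + d / A.δ * R * (2 * U / A.α) * (1 / √(A.φ (epoch A.Δ t) : ℝ)) := by
      intro t ht
      have := hA.sub_le_integral_inner hd hM (Finset.mem_Icc.1 ht).1 (hxS t) (hyS t)
      simp only [h, hproj, roundInput]
      linarith
    refine (Finset.sum_le_sum h1).trans ?_
    rw [Finset.sum_add_distrib, Finset.sum_add_distrib]
    refine add_le_add (le_of_eq (by rw [Finset.sum_const]; simp)) ?_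
    rw [← Finset.mul_sum]
    have h2 := sum_epoch_le hA.Δ_pos (g := fun τ => 1 / √(A.φ τ : ℝ)) (fun τ => by positivity) T
    have h3 : ((T / A.Δ : ℕ) : ℝ) ≤ T / A.Δ := Nat.cast_div_le
    have h4 : (1 : ℝ) ≤ T / A.Δ := by
      rw [one_le_div hΔ0]; exact_mod_cast hΔT
    have h5 : 0 ≤ ∑ τ ∈ Finset.Icc 1 A.Δ, 1 / √(A.φ τ : ℝ) :=
      Finset.sum_nonneg fun τ _ => by positivity
    have h6 : ∑ t ∈ Finset.Icc 1 T, 1 / √(A.φ (epoch A.Δ t) : ℝ) ≤ 2 * (T / A.Δ) * S := by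
      refine h2.trans ((mul_le_mul_of_nonneg_right (by linarith :
        ((T / A.Δ : ℕ) : ℝ) + 1 ≤ 2 * (T / A.Δ)) h5).trans ?_)
      exact mul_le_mul_of_nonneg_left hS (by positivity)
    calc d / A.δ * R * (2 * U / A.α) * ∑ t ∈ Finset.Icc 1 T, 1 / √(A.φ (epoch A.Δ t) : ℝ)
        ≤ d / A.δ * R * (2 * U / A.α) * (2 * (T / A.Δ) * S) :=
          mul_le_mul_of_nonneg_left h6 (by positivity)
      _ = _ := by ring
  -- the played action is at distance `δ` from the iterate
  have hexplore : ∑ t ∈ Finset.Icc 1 T,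
      (C t (A.action (fun t => u t ω) (fun t i => ξ t i ω) t) - C t (x t ω)) ≤
        T * (L * A.δ) := by
    have h1 : ∀ t ∈ Finset.Icc 1 T,
        C t (A.action (fun t => u t ω) (fun t i => ξ t i ω) t) - C t (x t ω) ≤ L * A.δ := by
      intro t _
      have := hClip t _ (hA.add_smul_mem (hxS t) (u t ω)) _ (hxS t).1
      rwa [add_sub_cancel_left, norm_smul, norm_eq_of_mem_sphere, mul_one,
        Real.norm_of_nonneg hδ.le] at this
    exact (Finset.sum_le_sum h1).trans (le_of_eq (by simp))
  -- the comparators are minimizers scaled by `1 - δ / r`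
  have hshrink : ∑ t ∈ Finset.Icc 1 T, (C t (y t) - C t (p t)) ≤ T * (L * (A.δ / A.r * R)) := by
    have h1 : ∀ t ∈ Finset.Icc 1 T, C t (y t) - C t (p t) ≤ L * (A.δ / A.r * R) := by
      intro t _
      refine (hClip t _ (hyS t).1 _ (hxX _)).trans (mul_le_mul_of_nonneg_left ?_ hL0)
      have e : y t - p t = -((A.δ / A.r) • p t) := by simp only [y]; module
      have h2 := hA.norm_sub_le (hxX (batchStart A.Δ t)) h0X
      rw [sub_zero] at h2
      rw [e, norm_neg, norm_smul, Real.norm_of_nonneg (by positivity)]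
      exact mul_le_mul_of_nonneg_left h2 (by positivity)
    exact (Finset.sum_le_sum h1).trans (le_of_eq (by simp))
  -- within a batch the minimizer is out of date by the variation of the noise distributions
  have hvar : ∑ t ∈ Finset.Icc 1 T, (C t (p t) - C t (xs t)) ≤ 2 * A.Δ * L * V := by
    have hfin : ∀ s ∈ Finset.Icc 2 T, wasserstein (D (s - 1)) (D s) ≠ ⊤ := fun s hs =>
      ne_top_of_le_ne_top ENNReal.ofReal_ne_top ((Finset.single_le_sum
        (f := fun t => wasserstein (D (t - 1)) (D t)) (fun _ _ => zero_le) hs).trans hW)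
    have h1 := sum_batchStart_sub_le (X := A.X) (C := C) hA.Δ_pos (T := T)
      (w := fun s => L * (wasserstein (D (s - 1)) (D s)).toReal) (fun s => by positivity)
      (fun s hs z hz => abs_riskCost_sub_le_wasserstein hA.cost hA.L_pos hα hA.α_le (hfin s hs) hz)
      (fun t ht => ⟨hxX t, hxs t ht⟩)
    refine h1.trans ?_
    rw [← Finset.mul_sum, ← ENNReal.toReal_sum hfin, ← mul_assoc]
    exact mul_le_mul_of_nonneg_left (ENNReal.toReal_le_of_le_ofReal hV hW) (by positivity)
  have hsplit : dynamicRegret C (A.action (fun t => u t ω) fun t i => ξ t i ω) xs T =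
      ∑ t ∈ Finset.Icc 1 T,
        (C t (A.action (fun t => u t ω) (fun t i => ξ t i ω) t) - C t (x t ω))
      + ∑ t ∈ Finset.Icc 1 T, (C t (x t ω) - C t (y t))
      + ∑ t ∈ Finset.Icc 1 T, (C t (y t) - C t (p t))
      + ∑ t ∈ Finset.Icc 1 T, (C t (p t) - C t (xs t)) := by
    simp only [dynamicRegret, Finset.sum_sub_distrib]; ring
  change dynamicRegret C (A.action (fun t => u t ω) fun t i => ξ t i ω) xs T ≤ bound
  have hεB : ε = d / A.δ * U * R * √(2 * T * Real.log (1 / γ)) := rfl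
  have e : T * L * A.δ * (3 + R / A.r) =
      T * (L * A.δ) + T * (2 * L * A.δ) + T * (L * (A.δ / A.r * R)) := by ring
  rw [hsplit, hbound, e, ← hεB]
  linarith

end AlgInput

/-! ### The choice of the parameters -/

/-- The constant of the regret bound for the exponent `a ≤ 1`. -/
noncomputable def regretConst (d : ℕ) (r U L₀ Dx α a c : ℝ) : ℝ :=
  d * U * |Dx| * (2 * √((r ^ (1 / a)) ^ (4 - 4 * a))) +
    (L₀ / α * (3 + |Dx| / r) + 8 * (d * |Dx| * (U / α)) * c
      + 2 * |Dx| ^ 2 * (r ^ (1 / a)) ^ (4 - 4 * a) + d ^ 2 * U ^ 2 / 2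
      + 2 * (L₀ / α) * (1 + (r ^ (1 / a)) ^ 4)) / √(Real.log 2)

lemma regretConst_pos (d : ℕ) {r U L₀ α c : ℝ} (Dx a : ℝ) (hr : 0 < r) (hU : 0 < U) (hL₀ : 0 < L₀)
    (hα : 0 < α) (hc : 0 < c) : 0 < regretConst d r U L₀ Dx α a c := by
  have : 0 < Real.log 2 := Real.log_pos one_lt_two
  unfold regretConst
  positivity

/-- With `q = (V/T)^(1/(4+a))`, the prescribed parameters are `δ = q^a`, `η = δ³` and `Δ ≈ q⁻⁴`, and
each term of the regret bound is at most of order `T δ`. -/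
lemma regret_rate {d : ℕ} {r U L₀ Dx α a c R : ℝ} (hr : 0 < r) (hU : 0 < U) (hL₀ : 0 < L₀)
    (hα : 0 < α) (ha : 0 < a) (ha1 : a ≤ 1) (hc : 0 < c) (hR : 0 ≤ R) (hRD : R ≤ Dx)
    {T : ℕ} (hT : 1 ≤ T) {V δ η : ℝ} {Δ : ℕ} (hV : 0 < V) (hδr : δ < r) (hΔ : 1 ≤ Δ) (hΔT : Δ ≤ T)
    (hδ : δ = (V / T) ^ (a / (4 + a))) (hη : η = (V / T) ^ (3 * a / (4 + a)))
    (hΔ' : |(Δ : ℝ) - (T / V) ^ (4 / (4 + a))| < 1) {γ : ℝ} (hγ : 0 < γ) (hγ1 : γ < 1) :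
    d / δ * U * R * √(2 * T * Real.log (1 / γ)) + T * (L₀ / α) * δ * (3 + R / r)
      + 2 * (T / Δ) * (d / δ * R * (2 * U / α)) * (c * (Δ : ℝ) ^ (1 - a / 2))
      + R ^ 2 * (T / Δ) / η + T * (η / 2 * (d / δ * U) ^ 2) + 2 * Δ * (L₀ / α) * V ≤
    regretConst d r U L₀ Dx α a c * √(Real.log (2 * T / γ)) *
      ((T : ℝ) ^ (4 / (4 + a)) * V ^ (a / (4 + a))) := by
  have hT0 : (0 : ℝ) < T := by exact_mod_cast hT
  have hΔ0 : (0 : ℝ) < Δ := by exact_mod_cast hΔ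
  have hΔT' : (Δ : ℝ) ≤ T := by exact_mod_cast hΔT
  have hvt : 0 < V / T := by positivity
  have h4a : 0 < 4 + a := by linarith
  set q := (V / T) ^ (1 / (4 + a)) with hq
  have hq0 : 0 < q := by positivity
  have hδq : δ = q ^ a := by rw [hδ, hq, ← Real.rpow_mul hvt.le]; congr 1; ring
  have hηδ : η = δ ^ 3 := by
    rw [hη, hδ, ← Real.rpow_natCast, ← Real.rpow_mul hvt.le]; congr 1; push_cast; ring
  have hδ0 : 0 < δ := by rw [hδ]; positivity
  have hκ : (T / V) ^ (4 / (4 + a)) = 1 / q ^ 4 := by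
    rw [hq, ← Real.rpow_natCast, ← Real.rpow_mul hvt.le, one_div, ← Real.inv_rpow hvt.le, inv_div]
    congr 1; push_cast; ring
  have hVq : V = T * (q ^ 4 * δ) := by
    have : q ^ 4 * δ = V / T := by
      rw [hδq, ← Real.rpow_natCast, ← Real.rpow_add hq0, hq, ← Real.rpow_mul hvt.le]
      have e : 1 / (4 + a) * (((4 : ℕ) : ℝ) + a) = 1 := by push_cast; field_simp
      rw [e, Real.rpow_one]
    rw [this]; field_simp
  have htarget : (T : ℝ) ^ (4 / (4 + a)) * V ^ (a / (4 + a)) = T * δ := by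
    have e : V = T * (V / T) := by field_simp
    nth_rw 1 [e]
    rw [Real.mul_rpow hT0.le hvt.le, ← hδ, ← mul_assoc, ← Real.rpow_add hT0]
    have e2 : 4 / (4 + a) + a / (4 + a) = 1 := by field_simp
    rw [e2, Real.rpow_one]
  rw [htarget]
  set ρ := r ^ (1 / a) with hρ
  have hqρ : q ≤ ρ := by
    have e : q = δ ^ (1 / a) := by
      rw [hδq, ← Real.rpow_mul hq0.le, mul_one_div_cancel ha.ne', Real.rpow_one]
    rw [e]
    exact Real.rpow_le_rpow hδ0.le hδr.le (by positivity)
  set Q := ρ ^ (4 - 4 * a) with hQ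
  have hQ0 : 0 ≤ Q := by positivity
  have hqQ : q ^ 4 ≤ Q * δ ^ 4 := by
    have e : q ^ 4 = q ^ (4 - 4 * a) * δ ^ 4 := by
      rw [hδq, ← Real.rpow_natCast, ← Real.rpow_natCast, ← Real.rpow_mul hq0.le,
        ← Real.rpow_add hq0]
      congr 1; push_cast; ring
    rw [e]
    exact mul_le_mul_of_nonneg_right (Real.rpow_le_rpow hq0.le hqρ (by linarith)) (by positivity)
  have hqρ4 : q ^ 4 ≤ ρ ^ 4 := pow_le_pow_left₀ hq0.le hqρ 4
  rw [hκ, abs_lt] at hΔ'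
  have hq4 : 0 < q ^ 4 := by positivity
  -- both bounds on the batch length follow from rounding, the first one also from `1 ≤ Δ`
  have hΔlow : 1 / (Δ : ℝ) ≤ 2 * q ^ 4 := by
    rw [div_le_iff₀ hΔ0]
    have h1 : q ^ 4 * (1 / q ^ 4) = 1 := by field_simp
    have h2 : (1 : ℝ) ≤ Δ := by exact_mod_cast hΔ
    have h3 : 1 / q ^ 4 ≤ 2 * Δ := by linarith [hΔ'.1]
    have h4 := mul_le_mul_of_nonneg_left h3 hq4.le
    linarith
  have hΔhigh : Δ * q ^ 4 ≤ 1 + q ^ 4 := by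
    have h1 : q ^ 4 * (1 / q ^ 4) = 1 := by field_simp
    have h2 := mul_le_mul_of_nonneg_left hΔ'.2.le hq4.le
    linarith
  set g := √(Real.log (2 * T / γ)) with hg
  have hlog2 : 0 < Real.log 2 := Real.log_pos one_lt_two
  have hlogle : Real.log 2 ≤ Real.log (2 * T / γ) := by
    refine Real.log_le_log zero_lt_two ?_
    rw [le_div_iff₀ hγ]
    have : (1 : ℝ) ≤ T := by exact_mod_cast hT
    nlinarith
  have hglow : 1 ≤ g / √(Real.log 2) := by
    rw [one_le_div (Real.sqrt_pos.2 hlog2)]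
    exact Real.sqrt_le_sqrt hlogle
  have hg0 : 0 ≤ g := Real.sqrt_nonneg _
  have hDx : R ≤ |Dx| := hRD.trans (le_abs_self _)
  have hTδ : 0 < T * δ := by positivity
  have t1 : d / δ * U * R * √(2 * T * Real.log (1 / γ)) ≤
      d * U * |Dx| * (2 * √Q) * g * (T * δ) := by
    have h1 : √(2 * T * Real.log (1 / γ)) ≤ √(2 * T) * g := by
      rw [Real.sqrt_mul (by positivity)]
      refine mul_le_mul_of_nonneg_left (Real.sqrt_le_sqrt ?_) (Real.sqrt_nonneg _)
      refine Real.log_le_log (by positivity) ?_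
      gcongr
      have : (1 : ℝ) ≤ T := by exact_mod_cast hT
      linarith
    have h2 : √(2 * T) ≤ 2 * √Q * (T * δ ^ 2) := by
      refine Real.sqrt_le_iff.2 ⟨by positivity, ?_⟩
      rw [mul_pow, mul_pow, Real.sq_sqrt hQ0]
      have h3 : 1 ≤ 2 * (Q * δ ^ 4) * T := by
        have h4 : 1 ≤ 2 * q ^ 4 * Δ := by rwa [div_le_iff₀ hΔ0] at hΔlow
        have h5 : 2 * q ^ 4 * Δ ≤ 2 * (Q * δ ^ 4) * T := by gcongr
        linarith
      have h6 := mul_le_mul_of_nonneg_left h3 (by positivity : (0 : ℝ) ≤ 2 * T)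
      linarith
    calc d / δ * U * R * √(2 * T * Real.log (1 / γ))
        ≤ d / δ * U * |Dx| * ((2 * √Q * (T * δ ^ 2)) * g) := by
          gcongr
          exact h1.trans (mul_le_mul_of_nonneg_right h2 hg0)
      _ = d * U * |Dx| * (2 * √Q) * g * (T * δ) := by field_simp
  have t2 : T * (L₀ / α) * δ * (3 + R / r) ≤ L₀ / α * (3 + |Dx| / r) * (T * δ) := by
    calc T * (L₀ / α) * δ * (3 + R / r) ≤ T * (L₀ / α) * δ * (3 + |Dx| / r) := by gcongr
      _ = _ := by ring
  have t3 : 2 * (T / Δ) * (d / δ * R * (2 * U / α)) * (c * (Δ : ℝ) ^ (1 - a / 2)) ≤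
      8 * (d * |Dx| * (U / α)) * c * (T * δ) := by
    have h1 : (Δ : ℝ) ^ (1 - a / 2) = Δ * (1 / Δ : ℝ) ^ (a / 2) := by
      rw [one_div, Real.inv_rpow hΔ0.le, Real.rpow_sub hΔ0, Real.rpow_one, div_eq_mul_inv]
    have h2 : (1 / Δ : ℝ) ^ (a / 2) ≤ 2 * δ ^ 2 := by
      calc (1 / Δ : ℝ) ^ (a / 2) ≤ (2 * q ^ 4) ^ (a / 2) :=
            Real.rpow_le_rpow (by positivity) hΔlow (by positivity)
        _ = 2 ^ (a / 2) * δ ^ 2 := by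
            rw [Real.mul_rpow zero_le_two hq4.le, hδq, ← Real.rpow_natCast, ← Real.rpow_natCast,
              ← Real.rpow_mul hq0.le, ← Real.rpow_mul hq0.le]
            congr 2; push_cast; ring
        _ ≤ 2 * δ ^ 2 := by
            gcongr
            exact (Real.rpow_le_rpow_of_exponent_le one_le_two (by linarith)).trans
              (Real.rpow_one 2).le
    calc 2 * (T / Δ) * (d / δ * R * (2 * U / α)) * (c * (Δ : ℝ) ^ (1 - a / 2))
        ≤ 2 * (T / Δ) * (d / δ * |Dx| * (2 * U / α)) * (c * (Δ * (2 * δ ^ 2))) := by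
          rw [h1]; gcongr
      _ = 8 * (d * |Dx| * (U / α)) * c * (T * δ) := by field_simp; ring
  have t4 : R ^ 2 * (T / Δ) / η ≤ 2 * |Dx| ^ 2 * Q * (T * δ) := by
    rw [hηδ]
    calc R ^ 2 * (T / Δ) / δ ^ 3 = R ^ 2 * (T * (1 / Δ)) / δ ^ 3 := by ring
      _ ≤ |Dx| ^ 2 * (T * (2 * (Q * δ ^ 4))) / δ ^ 3 := by
          gcongr
          linarith
      _ = 2 * |Dx| ^ 2 * Q * (T * δ) := by field_simp
  have t5 : T * (η / 2 * (d / δ * U) ^ 2) = d ^ 2 * U ^ 2 / 2 * (T * δ) := by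
    rw [hηδ]; field_simp
  have t6 : 2 * Δ * (L₀ / α) * V ≤ 2 * (L₀ / α) * (1 + ρ ^ 4) * (T * δ) := by
    calc 2 * Δ * (L₀ / α) * V = 2 * (L₀ / α) * (Δ * q ^ 4) * (T * δ) := by rw [hVq]; ring
      _ ≤ 2 * (L₀ / α) * (1 + ρ ^ 4) * (T * δ) := by gcongr; linarith
  set N := L₀ / α * (3 + |Dx| / r) + 8 * (d * |Dx| * (U / α)) * c + 2 * |Dx| ^ 2 * Q
    + d ^ 2 * U ^ 2 / 2 + 2 * (L₀ / α) * (1 + ρ ^ 4) with hN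
  have hN0 : 0 ≤ N := by positivity
  have hsum : N * (T * δ) ≤ N / √(Real.log 2) * g * (T * δ) := by
    refine mul_le_mul_of_nonneg_right ?_ hTδ.le
    calc N = N * 1 := (mul_one N).symm
      _ ≤ N * (g / √(Real.log 2)) := mul_le_mul_of_nonneg_left hglow hN0
      _ = N / √(Real.log 2) * g := by ring
  have e : regretConst d r U L₀ Dx α a c * g * (T * δ) =
      d * U * |Dx| * (2 * √Q) * g * (T * δ) + N / √(Real.log 2) * g * (T * δ) := by
    rw [regretConst]; ring
  have e2 : N * (T * δ) = L₀ / α * (3 + |Dx| / r) * (T * δ) +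
      8 * (d * |Dx| * (U / α)) * c * (T * δ) + 2 * |Dx| ^ 2 * Q * (T * δ)
      + d ^ 2 * U ^ 2 / 2 * (T * δ) + 2 * (L₀ / α) * (1 + ρ ^ 4) * (T * δ) := by rw [hN]; ring
  rw [e, t5]
  linarith

end RiskAverse

theorem theorem1 (d : ℕ) (hd : 1 ≤ d) (r U L₀ Dx α a c : ℝ) (hr : 0 < r) (hU : 0 < U)
    (hL₀ : 0 < L₀) (hα : 0 < α) (hα1 : α ≤ 1) (ha : 0 < a) (hc : 0 < c) :
    ∃ K : ℝ, 0 < K ∧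
      ∀ {Ξ : Type*} [MetricSpace Ξ] [MeasurableSpace Ξ] [BorelSpace Ξ]
        {Ω : Type*} [MeasurableSpace Ω] (P : Measure Ω) [IsProbabilityMeasure P]
        -- the feasible set and the cost
        (X : Set (Vec d)) (_ : Convex ℝ X) (_ : IsCompact X)
        (_ : Metric.closedBall 0 r ⊆ X) (_ : Metric.diam X ≤ Dx)
        (J : Vec d → Ξ → ℝ)
        (_ : ∀ x ∈ X, ∀ z, |J x z| ≤ U)
        (_ : ∀ z, ConvexOn ℝ X fun x => J x z)
        (_ : ∀ z, ∀ x ∈ X, ∀ y ∈ X, |J x z - J y z| ≤ L₀ * ‖x - y‖)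
        (_ : ∀ x ∈ X, ∀ z w, |J x z - J x w| ≤ L₀ * dist z w)
        -- the horizon, the noise distributions and their variation budget
        (T : ℕ) (_ : 1 ≤ T) (D : ℕ → Measure Ξ) (_ : ∀ t, IsProbabilityMeasure (D t))
        (V : ℝ) (_ : 0 < V)
        (_ : ∑ t ∈ Finset.Icc 2 T, wasserstein (D (t - 1)) (D t) ≤ ENNReal.ofReal V)
        -- the parameters of the algorithm
        (δ η : ℝ) (Δ : ℕ) (_ : δ < r) (_ : 1 ≤ Δ) (_ : Δ ≤ T)
        (φ : ℕ → ℕ) (_ : ∀ τ ∈ Finset.Icc 1 Δ, 1 ≤ φ τ)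
        (_ : ∑ τ ∈ Finset.Icc 1 Δ, 1 / √(φ τ : ℝ) ≤ c * (Δ : ℝ) ^ (1 - a / 2))
        (x₁ : Vec d) (_ : x₁ ∈ shrunkSet X r δ)
        -- the randomness of the algorithm, and the one-step optimal actions
        (u : ℕ → Ω → UnitSphere d) (ξ : ℕ → ℕ → Ω → Ξ) (_ : SampleModel P D u ξ)
        (xstar : ℕ → Vec d)
        (_ : ∀ t ∈ Finset.Icc 1 T, xstar t ∈ X ∧ IsMinOn (riskCost J α (D t)) X (xstar t))
        (γ : ℝ) (_ : 0 < γ) (_ : γ < 1),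
        let A : AlgInput d Ξ :=
          { X := X, r := r, J := J, α := α, Δ := Δ, δ := δ, φ := φ, σ := fun _ => η, init := x₁ }
        let DR : Ω → ℝ := fun ω =>
          dynamicRegret (fun t => riskCost J α (D t))
            (A.action (fun t => u t ω) (fun t i => ξ t i ω)) xstar T
        ((a ≤ 1 ∧ δ = (V / T) ^ (a / (4 + a)) ∧ η = (V / T) ^ (3 * a / (4 + a)) ∧
            |(Δ : ℝ) - (T / V) ^ (4 / (4 + a))| < 1) →
          1 - γ ≤ P.real {ω | DR ω ≤
            K * √(Real.log (2 * T / γ)) * ((T : ℝ) ^ (4 / (4 + a)) * V ^ (a / (4 + a)))}) ∧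
        ((1 < a ∧ δ = (V / T) ^ (1 / 5 : ℝ) ∧ η = (V / T) ^ (3 / 5 : ℝ) ∧
            |(Δ : ℝ) - (T / V) ^ (4 / 5 : ℝ)| < 1) →
          1 - γ ≤ P.real {ω | DR ω ≤
            K * √(Real.log (2 * T / γ)) * ((T : ℝ) ^ (4 / 5 : ℝ) * V ^ (1 / 5 : ℝ))}) := by
  have hb : 0 < min a 1 := lt_min ha one_pos
  refine ⟨regretConst d r U L₀ Dx α (min a 1) c, regretConst_pos d Dx _ hr hU hL₀ hα hc, ?_⟩
  intro Ξ _ _ _ Ω _ P _ X hXc hXk hball hdiam J hJU hJc hJL hJn T hT D hD V hV hW δ η Δ hδr hΔ hΔT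
    φ hφ hsum x₁ hx₁ u ξ hM xstar hxs γ hγ hγ1 A DR
  have main : ∀ b, 0 < b → b ≤ 1 → b ≤ a → δ = (V / T) ^ (b / (4 + b)) →
      η = (V / T) ^ (3 * b / (4 + b)) → |(Δ : ℝ) - (T / V) ^ (4 / (4 + b))| < 1 →
      1 - γ ≤ P.real {ω | DR ω ≤ regretConst d r U L₀ Dx α b c * √(Real.log (2 * T / γ)) *
        ((T : ℝ) ^ (4 / (4 + b)) * V ^ (b / (4 + b)))} := by
    intro b hb0 hb1 hba hδ hη hΔ'
    have hT0 : (0 : ℝ) < T := by exact_mod_cast hT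
    have hδ0 : 0 < δ := by rw [hδ]; positivity
    have hη0 : 0 < η := by rw [hη]; positivity
    have hA : A.IsRegular U L₀ :=
      { convex := hXc, compact := hXk, ball_subset := hball
        cost := ⟨hJU, hJc, hJL, hJn⟩
        U_pos := hU, L_pos := hL₀, α_pos := hα, α_le := hα1, δ_pos := hδ0, δ_lt := hδr
        Δ_pos := hΔ, φ_pos := hφ, init_mem := hx₁ }
    have hS : ∑ τ ∈ Finset.Icc 1 Δ, 1 / √(φ τ : ℝ) ≤ c * (Δ : ℝ) ^ (1 - b / 2) := by
      refine hsum.trans (mul_le_mul_of_nonneg_left ?_ hc.le)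
      exact Real.rpow_le_rpow_of_exponent_le (by exact_mod_cast hΔ) (by linarith)
    -- comparators outside the horizon are replaced by a feasible point
    let xs : ℕ → Vec d := fun t => if t ∈ Finset.Icc 1 T then xstar t else 0
    have hxs_eq : ∀ t ∈ Finset.Icc 1 T, xs t = xstar t := fun t ht => if_pos ht
    have h0X : (0 : Vec d) ∈ X := hball (Metric.mem_closedBall_self hr.le)
    have hxX : ∀ t, xs t ∈ X := by
      intro t
      by_cases ht : t ∈ Finset.Icc 1 T
      · rw [hxs_eq t ht]; exact (hxs t ht).1
      · simpa only [xs, if_neg ht] using h0X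
    have hbound := hA.regret_bound hd hM hη0 (fun _ => rfl) hT hΔT hV.le hW hxX
      (fun t ht => by rw [hxs_eq t ht]; exact (hxs t ht).2) hS hγ hγ1
    refine hbound.trans (measureReal_mono fun ω hω => ?_)
    have hDR : DR ω = dynamicRegret (fun t => riskCost A.J A.α (D t))
        (A.action (fun t => u t ω) fun t i => ξ t i ω) xs T := by
      simp only [DR, dynamicRegret]
      congr 1
      exact Finset.sum_congr rfl fun t ht => by rw [hxs_eq t ht]
    rw [Set.mem_ofPred_eq] at hω ⊢
    rw [hDR]
    exact hω.trans (regret_rate hr hU hL₀ hα hb0 hb1 hc Metric.diam_nonneg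
      hdiam hT hV hδr hΔ hΔT hδ hη hΔ' hγ hγ1)
  refine ⟨fun ⟨h1, h2, h3, h4⟩ => ?_, fun ⟨h1, h2, h3, h4⟩ => ?_⟩
  · rw [min_eq_left h1]
    exact main a ha h1 le_rfl h2 h3 h4
  · rw [min_eq_right h1.le]
    have e1 : (1 : ℝ) / (4 + 1) = 1 / 5 := by norm_num
    have e2 : (3 : ℝ) * 1 / (4 + 1) = 3 / 5 := by norm_num
    have e3 : (4 : ℝ) / (4 + 1) = 4 / 5 := by norm_num
    have h := main 1 one_pos le_rfl h1.le
    rw [e1, e2, e3] at h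
    exact h h2 h3 h4
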